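/- A turnstile stream over $[n]$ of length $m$ is a sequence of updates $(i_t,\Delta_t)$, $t\in[m]$, with $i_t\in[n]$ and $\Delta_t\in\{-M,\ldots,M\}$ an integer; it defines the vector $x\in\mathbb{Z}^n$ by $x_i=\sum_{t:\,i_t=i}\Delta_t$. A streaming algorithm that uses $s$ bits of space reads the updates once, in order, and keeps only $s$ bits of memory from one update to the next. It may toss up to $s$ fresh fair coins when it starts, at each update, and when it answers; coin tosses that are not kept in memory are forgotten (there is no random oracle). Its initial memory, its transitions and its answer are given by functions that are computable uniformly in $n$. At the end of the stream it outputs an index $i^*\in[n]$ or a failure symbol $\bot$. **Theorem.** Let $G(z)=\log(1+|z|)$. For all constants $a\in\mathbb{N}$ and $c>0$ there is a perfect $G$-sampler on turnstile streams that uses $O(\log^3 n)$ bits of space and succeeds with probability at least $0.99$, where the constant in $O(\cdot)$ depends only on $a$ and $c$. That is, there is a streaming algorithm with this space bound such that, for every $n\ge 1$ and every turnstile stream over $[n]$ with $m\le n^a$ and $M\le n^a$ that defines a vector $x\neq 0$, we have $\Pr[i^*\neq\bot]\ge 0.99$, and for every $i\in[n]$ $$\left|\Pr\left[i^*=i\mid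 i^*\neq\bot\right]-\frac{\log(1+|x_i|)}{\sum_{j\in[n]}\log(1+|x_j|)}\right|\le n^{-c}.$$ -/

import Mathlib

open Asymptotics Filter

/-- A turnstile stream over the universe `Fin n`: a finite sequence of updates `(i, Δ)`, each of
which adds the (positive or negative) integer `Δ` to coordinate `i`. -/
abbrev TurnstileStream (n : ℕ) : Type := List (Fin n × ℤ)

namespace TurnstileStream

/-- The frequency vector of a stream: `x i` is the sum of all `Δ` over the updates `(i, Δ)`. -/
def freq {n : ℕ} (σ : TurnstileStream n) (i : Fin n) : ℤ :=
  ((σ.filter fun u => u.1 = i).map Prod.snd).sum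

/-- The stream has at most `m` updates, and every increment lies in `{-M, …, M}`. -/
def BoundedBy {n : ℕ} (σ : TurnstileStream n) (m M : ℕ) : Prop :=
  σ.length ≤ m ∧ ∀ u ∈ σ, |u.2| ≤ (M : ℤ)

end TurnstileStream

/-- A randomized one-pass streaming algorithm, uniform in the universe size `n`.

Between two updates the algorithm remembers nothing but its memory, which consists of `space n`
bits and is represented by a natural number below `2 ^ space n`. In each step (initialization, the
processing of one update, the final answer) it may toss `space n` fresh fair coins; their outcomes
are handed to the step as a number `w < 2 ^ space n` and are forgotten afterwards unless they are
kept in memory. There is no random oracle and no second pass. The same code, that is, the same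
computable functions, serves all universe sizes. -/
structure StreamingAlgorithm where
  /-- The number of bits of space for the universe size `n`. -/
  space : ℕ → ℕ
  /-- `init n w` is the initial memory. -/
  init : ℕ → ℕ → ℕ
  /-- `update n s i Δ w` is the memory after the update `(i, Δ)` has arrived in memory `s`. -/
  update : ℕ → ℕ → ℕ → ℤ → ℕ → ℕ
  /-- `output n s w` is the answer at the end of the stream: a value below `n` is that index, any
  other value is the failure symbol. -/
  output : ℕ → ℕ → ℕ → ℕ
  init_lt : ∀ n w, init n w < 2 ^ space n
  update_lt : ∀ n s i Δ w, update n s i Δ w < 2 ^ space n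
  computable_space : Computable space
  computable_init : Computable fun q : ℕ × ℕ => init q.1 q.2
  computable_update : Computable fun q : ℕ × ℕ × ℕ × ℤ × ℕ =>
    update q.1 q.2.1 q.2.2.1 q.2.2.2.1 q.2.2.2.2
  computable_output : Computable fun q : ℕ × ℕ × ℕ => output q.1 q.2.1 q.2.2

namespace StreamingAlgorithm

noncomputable section

/-- The outcome of the fair coins of one step: uniform on the words of `space n` bits. -/
def coins (A : StreamingAlgorithm) (n : ℕ) : PMF (Fin (2 ^ A.space n)) :=
  PMF.uniformOfFintype _

/-- The law of the memory after one update, from a random memory with law `μ`, with fresh coins. -/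
def stepLaw (A : StreamingAlgorithm) (n : ℕ) (μ : PMF ℕ) (u : Fin n × ℤ) : PMF ℕ :=
  μ.bind fun s => (A.coins n).map fun w => A.update n s u.1 u.2 w

/-- The law of the memory after the whole stream, read from left to right. -/
def memoryLaw (A : StreamingAlgorithm) {n : ℕ} (σ : TurnstileStream n) : PMF ℕ :=
  σ.foldl (A.stepLaw n) ((A.coins n).map fun w => A.init n w)

/-- The law of the answer after the whole stream; `none` is the failure symbol `⊥`. -/
def outputLaw (A : StreamingAlgorithm) {n : ℕ} (σ : TurnstileStream n) : PMF (Option (Fin n)) :=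
  (A.memoryLaw σ).bind fun s => (A.coins n).map fun w =>
    if h : A.output n s w < n then some ⟨A.output n s w, h⟩ else none

end

end StreamingAlgorithm

/-- The probability that the answer is not `⊥`. -/
noncomputable def successProb {n : ℕ} (μ : PMF (Option (Fin n))) : ℝ :=
  1 - (μ none).toReal

/-- The probability that the answer is `i`, conditioned on the answer not being `⊥`. -/
noncomputable def condProb {n : ℕ} (μ : PMF (Option (Fin n))) (i : Fin n) : ℝ :=
  (μ (some i)).toReal / successProb μ

/-- `μ` is the law of an `ε`-approximate `G`-sample from the vector `x` with additive distortion
`η` and success probability at least `p`: conditioned on success, each index `i` has probability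
`(1 ± ε) * G (x i) / ∑ j, G (x j) ± η`. -/
structure IsGSample {n : ℕ} (G : ℝ → ℝ) (ε η p : ℝ) (x : Fin n → ℝ)
    (μ : PMF (Option (Fin n))) : Prop where
  success : p ≤ successProb μ
  lower : ∀ i, (1 - ε) * (G (x i) / ∑ j, G (x j)) - η ≤ condProb μ i
  upper : ∀ i, condProb μ i ≤ (1 + ε) * (G (x i) / ∑ j, G (x j)) + η

/-- `A` is a perfect `G`-sampler (that is, `ε = 0`) with additive distortion `n ^ (-c)` and success
probability at least `p`, on all turnstile streams with at most `n ^ a` updates, each of magnitude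
at most `n ^ a`, that define a vector `x` with `∑ j, G (x j) ≠ 0`; without this last condition the
target distribution does not exist. -/
def IsPerfectGSampler (A : StreamingAlgorithm) (G : ℝ → ℝ) (a : ℕ) (c p : ℝ) : Prop :=
  ∀ (n : ℕ) (σ : TurnstileStream n), σ.BoundedBy (n ^ a) (n ^ a) →
    ∑ j, G (σ.freq j : ℝ) ≠ 0 →
    IsGSample G 0 ((n : ℝ) ^ (-c)) p (fun i => (σ.freq i : ℝ)) (A.outputLaw σ)

/-! Let V = n^(2a), which bounds every |x_j|. If j is uniform on the support of x and is kept with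
probability log(1+|x_j|)/log(1+V), then a kept index has exactly the required law. The sampler runs
independent trials of this kind. Since |x_j| ≥ 1 on the support, a trial succeeds with probability
of order at least 1/log(1+V), so O(log n) trials suffice. The last successful trial has the law of
one trial conditioned on success (`mul_rangeProb_lastDigitOut`).

A nearly uniform element of the support comes from nested subsampling. A random polynomial over F_p
with t = O(log n) coefficients gives every index a roughly geometric level, and j is selected if its
level is strictly deepest. Some index is selected with probability at least 1/16
(`one_div_sixteen_le_sum_isolateProb`). All indices are selected with almost the same probability
(`abs_isolateProb_sub_le`). To see this, fix the level k of j. If few other indices are expected in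
level k, inclusion-exclusion truncated at order m < t needs only t-wise independence, so up to an
error 2^(-m) its value depends only on the size of the support. If many are expected, level k almost
surely contains another index, so the contribution is negligible for every j.

Isolation is detected by linear fingerprints, which makes deletions harmless. For each trial and
level a counter holds, modulo p, the sum of x_i r^i over the indices of the level, with one random
base r common to all counters. By a union bound over roots of polynomials (`rangeProb_badBase_le`) r
is almost surely good, and then a counter congruent to v r^j certifies that the restricted vector is
v at j and 0 elsewhere (`finds_iff`).

There are O(log n) trials, each with O(log n) coefficients and O(log n) counters of O(log n) bits,
hence O(log^3 n) bits. Randomness is used only for the initial seed. Every test, including the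
comparison with a ratio of logarithms, is one of integers, so all maps are primitive recursive. -/

/-! ### Closure properties of primitive recursive functions -/

section Primrec

variable {α : Type*} [Primcodable α]

theorem Primrec.nat_pow : Primrec₂ ((· ^ ·) : ℕ → ℕ → ℕ) :=
  Primrec₂.unpaired'.1 Nat.Primrec.pow

theorem Primrec.sum_range {g : α → ℕ} {f : α → ℕ → ℕ} (hg : Primrec g) (hf : Primrec₂ f) :
    Primrec fun a => ∑ i ∈ Finset.range (g a), f a i := by
  refine (Primrec.nat_rec' (h := fun a x => x.2 + f a x.1) hg (.const 0) ?_).of_eq fun a => ?_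
  · exact Primrec.nat_add.comp (Primrec.snd.comp Primrec.snd)
      (hf.comp Primrec.fst (Primrec.fst.comp Primrec.snd))
  · induction g a with
    | zero => rfl
    | succ m ih => rw [Finset.sum_range_succ, ← ih]

theorem PrimrecPred.bounded_exists {g : α → ℕ} {q : α → ℕ → Prop} (hg : Primrec g)
    (hq : PrimrecRel q) : PrimrecPred fun a => ∃ i < g a, q a i := by
  refine (PrimrecRel.exists_mem_list hq.swap |>.comp (Primrec.list_range.comp hg)
    Primrec.id).of_eq fun a => ?_
  simp [Function.swap]

/-- Integers are encoded as 2k for k ≥ 0 and as 2k + 1 for -(k + 1). The parity of the code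
therefore gives the sign and its half gives k; the residue of -(k + 1) is p - 1 - (k mod p). -/
theorem Primrec.int_emod_toNat :
    Primrec₂ fun (Δ : ℤ) (p : ℕ) => if p = 0 then 0 else (Δ % (p : ℤ)).toNat := by
  have h : Primrec₂ fun (Δ : ℤ) (p : ℕ) =>
      if p = 0 then 0 else if Encodable.encode Δ % 2 = 0 then (Encodable.encode Δ / 2) % p
        else p - 1 - (Encodable.encode Δ / 2) % p := by
    have e : Primrec fun x : ℤ × ℕ => Encodable.encode x.1 := Primrec.encode.comp Primrec.fst
    have d : Primrec fun x : ℤ × ℕ => (Encodable.encode x.1 / 2) % x.2 :=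
      Primrec.nat_mod.comp (Primrec.nat_div.comp e (.const 2)) Primrec.snd
    exact Primrec.ite (Primrec.eq.comp Primrec.snd (.const 0)) (.const 0)
      (Primrec.ite (Primrec.eq.comp (Primrec.nat_mod.comp e (.const 2)) (.const 0)) d
        (Primrec.nat_sub.comp (Primrec.nat_sub.comp Primrec.snd (.const 1)) d))
  refine h.of_eq fun Δ p => ?_
  rcases Nat.eq_zero_or_pos p with rfl | hp
  · simp
  rw [if_neg hp.ne', if_neg hp.ne']
  cases Δ with
  | ofNat k =>
    have : Encodable.encode (Int.ofNat k) = 2 * k := rfl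
    rw [this]
    simp only [Nat.mul_mod_right, if_true]
    rw [Nat.mul_div_cancel_left _ two_pos]
    simp only [Int.ofNat_eq_natCast]
    omega
  | negSucc k =>
    have : Encodable.encode (Int.negSucc k) = 2 * k + 1 := rfl
    rw [this, if_neg (by omega), show (2 * k + 1) / 2 = k by omega,
      Int.negSucc_emod _ (by exact_mod_cast hp)]
    have := Nat.mod_lt k hp
    omega

theorem Primrec.nat_log_two : Primrec (Nat.log 2) := by
  refine (Primrec.nat_findGreatest (p := fun n k => 2 ^ k ≤ n) Primrec.id ?_).of_eq fun n => ?_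
  · exact Primrec.nat_le.comp (Primrec.nat_pow.comp (.const 2) Primrec.snd) Primrec.fst
  · rw [id, Nat.findGreatest_eq_iff]
    refine ⟨Nat.log_le_self 2 n, fun h => Nat.pow_log_le_self 2 ?_, fun {k} hk _ h => ?_⟩
    · rintro rfl; simp at h
    · exact absurd (Nat.lt_pow_of_log_lt one_lt_two hk) (by omega)

theorem Primrec.nat_prime : PrimrecPred Nat.Prime := by
  have hd : PrimrecRel fun p m : ℕ => 2 ≤ m ∧ p % m = 0 :=
    (Primrec.nat_le.comp (.const 2) Primrec.snd).and
      (Primrec.eq.comp (Primrec.nat_mod.comp Primrec.fst Primrec.snd) (.const 0))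
  have h : PrimrecPred fun p : ℕ => 2 ≤ p ∧ ¬ ∃ m < p, 2 ≤ m ∧ p % m = 0 :=
    (Primrec.nat_le.comp (.const 2) Primrec.id).and
      (PrimrecPred.bounded_exists Primrec.id hd).not
  refine h.of_eq fun p => ?_
  rw [Nat.prime_def_lt']
  refine and_congr_right fun _ => ?_
  push Not
  exact forall_congr' fun m => ⟨fun h1 h2 h3 h4 => h1 h3 h2 (Nat.mod_eq_zero_of_dvd h4),
    fun h1 h2 h3 h4 => h1 h3 h2 (Nat.dvd_of_mod_eq_zero h4)⟩

end Primrec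

/-! ### The sampler -/

namespace LogSampler

/-- The numerical parameters of the sampler: the prime modulus `p`, the number `L` of subsampling
levels, the number `R` of repetitions, the number `t` of coefficients of a hash function, the
number `w` of bits of a counter, and the bound `V` for the entries of the frequency vector. -/
structure Params where
  p : ℕ
  L : ℕ
  R : ℕ
  t : ℕ
  w : ℕ
  V : ℕ

/-- The value at `i` of the polynomial modulo `p` whose `t` coefficients are the base-`p` digits
of `y`. -/
def polyHash (p t y i : ℕ) : ℕ := (∑ e ∈ Finset.range t, y / p ^ e % p * i ^ e) % p

/-- The last nonzero value among `f 0, …, f (R - 1)`, or zero. -/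
def lastNonzero (f : ℕ → ℕ) : ℕ → ℕ
  | 0 => 0
  | R + 1 => if f R = 0 then lastNonzero f R else f R

namespace Params

variable (P : Params)

/-- The number of seeds of one repetition. -/
def repSeeds : ℕ := P.p ^ (P.t + 1)

/-- The number of seeds. -/
def seeds : ℕ := P.p * P.repSeeds ^ P.R

/-- The number of values of the linear sketch. -/
def sketches : ℕ := 2 ^ (P.w * (P.R * P.L))

/-- The part of the seed that belongs to repetition `ρ`. -/
def repSeed (z ρ : ℕ) : ℕ := z / P.p / P.repSeeds ^ ρ % P.repSeeds

/-- Whether index `i` belongs to level `k` for the seed `y` of a repetition. -/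
def InLevel (y k i : ℕ) : Prop := polyHash P.p P.t (y / P.p) i * 2 ^ k < P.p

instance (y k i : ℕ) : Decidable (P.InLevel y k i) := inferInstanceAs (Decidable (_ < _))

/-- The contribution of the index `i` to the sketch. -/
def column (z i : ℕ) : ℕ :=
  ∑ c ∈ Finset.range (P.R * P.L),
    (if P.InLevel (P.repSeed z (c / P.L)) (c % P.L) i then (z % P.p) ^ i % P.p else 0) *
      2 ^ (P.w * c)

/-- The memory after an update. -/
def update (s i : ℕ) (Δ : ℤ) : ℕ :=
  s % P.seeds + P.seeds *
    ((s / P.seeds + (if P.p = 0 then 0 else (Δ % (P.p : ℤ)).toNat) * P.column (s % P.seeds) i)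
      % P.sketches)

/-- The counter number `c` of the sketch `x`. -/
def cell (x c : ℕ) : ℕ := x / 2 ^ (P.w * c) % 2 ^ P.w

/-- The rejection step: the coin `u < p` accepts the absolute value `v`. -/
def Accepts (u v : ℕ) : Prop := (1 + P.V) ^ u < (1 + v) ^ P.p

instance (u v : ℕ) : Decidable (P.Accepts u v) := inferInstanceAs (Decidable (_ < _))

/-- In repetition `ρ` with seed `z` and sketch `x`, some level has the counter of a vector
supported on `j` alone, and the value at `j` is accepted. -/
def Finds (z x ρ j : ℕ) : Prop :=
  ∃ k < P.L, ∃ v < P.V + 1, (0 < v ∧ P.Accepts (P.repSeed z ρ % P.p) v) ∧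
    (P.cell x (ρ * P.L + k) % P.p = v * (z % P.p) ^ j % P.p ∨
      (P.cell x (ρ * P.L + k) + v * (z % P.p) ^ j) % P.p = 0)

open Classical in
/-- One more than the index found by repetition `ρ`, or zero. -/
noncomputable def repOut (n z x ρ : ℕ) : ℕ :=
  ∑ j ∈ Finset.range n, if P.Finds z x ρ j then j + 1 else 0

/-- The answer for the seed `z` and the sketch `x`. -/
noncomputable def answer (n z x : ℕ) : ℕ :=
  if lastNonzero (P.repOut n z x) P.R = 0 then n else lastNonzero (P.repOut n z x) P.R - 1

end Params

/-! ### Computability: all maps of the sampler are primitive recursive. -/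

section Primrec

variable {α : Type*} [Primcodable α]

theorem primrec_polyHash {p t y i : α → ℕ} (hp : Primrec p) (ht : Primrec t) (hy : Primrec y)
    (hi : Primrec i) : Primrec fun a => polyHash (p a) (t a) (y a) (i a) := by
  refine Primrec.nat_mod.comp (Primrec.sum_range ht ?_) hp
  have f := Primrec.fst (α := α) (β := ℕ)
  have s := Primrec.snd (α := α) (β := ℕ)
  exact Primrec.nat_mul.comp (Primrec.nat_mod.comp (Primrec.nat_div.comp (hy.comp f)
    (Primrec.nat_pow.comp (hp.comp f) s)) (hp.comp f)) (Primrec.nat_pow.comp (hi.comp f) s)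

theorem primrec_lastNonzero {f : α → ℕ → ℕ} {R : α → ℕ} (hf : Primrec₂ f) (hR : Primrec R) :
    Primrec fun a => lastNonzero (f a) (R a) := by
  refine (Primrec.nat_rec' (h := fun a x => if f a x.1 = 0 then x.2 else f a x.1) hR
    (.const 0) ?_).of_eq fun a => ?_
  · have := hf.comp (Primrec.fst (α := α) (β := ℕ × ℕ)) (Primrec.fst.comp Primrec.snd)
    exact Primrec.ite (Primrec.eq.comp this (.const 0)) (Primrec.snd.comp Primrec.snd) this
  · induction R a with
    | zero => rfl
    | succ m ih => simp only [lastNonzero, ← ih]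

/-- A family of parameters all of whose components are primitive recursive. -/
structure PrimrecParams (P : α → Params) : Prop where
  p : Primrec fun a => (P a).p
  L : Primrec fun a => (P a).L
  R : Primrec fun a => (P a).R
  t : Primrec fun a => (P a).t
  w : Primrec fun a => (P a).w
  V : Primrec fun a => (P a).V

namespace PrimrecParams

variable {P : α → Params} (hP : PrimrecParams P)
include hP

theorem comp {β : Type*} [Primcodable β] {f : β → α} (hf : Primrec f) :
    PrimrecParams fun b => P (f b) :=
  ⟨hP.p.comp hf, hP.L.comp hf, hP.R.comp hf, hP.t.comp hf, hP.w.comp hf, hP.V.comp hf⟩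

theorem repSeeds : Primrec fun a => (P a).repSeeds :=
  Primrec.nat_pow.comp hP.p (Primrec.succ.comp hP.t)

theorem seeds : Primrec fun a => (P a).seeds :=
  Primrec.nat_mul.comp hP.p (Primrec.nat_pow.comp hP.repSeeds hP.R)

theorem sketches : Primrec fun a => (P a).sketches :=
  Primrec.nat_pow.comp (.const 2) (Primrec.nat_mul.comp hP.w (Primrec.nat_mul.comp hP.R hP.L))

theorem repSeed {z ρ : α → ℕ} (hz : Primrec z) (hρ : Primrec ρ) :
    Primrec fun a => (P a).repSeed (z a) (ρ a) :=
  Primrec.nat_mod.comp (Primrec.nat_div.comp (Primrec.nat_div.comp hz hP.p)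
    (Primrec.nat_pow.comp hP.repSeeds hρ)) hP.repSeeds

theorem inLevel {y k i : α → ℕ} (hy : Primrec y) (hk : Primrec k) (hi : Primrec i) :
    PrimrecPred fun a => (P a).InLevel (y a) (k a) (i a) :=
  Primrec.nat_lt.comp (Primrec.nat_mul.comp (primrec_polyHash hP.p hP.t
    (Primrec.nat_div.comp hy hP.p) hi) (Primrec.nat_pow.comp (.const 2) hk)) hP.p

theorem column {z i : α → ℕ} (hz : Primrec z) (hi : Primrec i) :
    Primrec fun a => (P a).column (z a) (i a) := by
  have f := Primrec.fst (α := α) (β := ℕ)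
  have s := Primrec.snd (α := α) (β := ℕ)
  have hP' := hP.comp f
  exact Primrec.sum_range (Primrec.nat_mul.comp hP.R hP.L) (Primrec.nat_mul.comp
    (Primrec.ite (hP'.inLevel (hP'.repSeed (hz.comp f) (Primrec.nat_div.comp s hP'.L))
      (Primrec.nat_mod.comp s hP'.L) (hi.comp f))
      (Primrec.nat_mod.comp (Primrec.nat_pow.comp (Primrec.nat_mod.comp (hz.comp f) hP'.p)
        (hi.comp f)) hP'.p) (.const 0))
    (Primrec.nat_pow.comp (.const 2) (Primrec.nat_mul.comp hP'.w s)))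

theorem update {s i : α → ℕ} {Δ : α → ℤ} (hs : Primrec s) (hi : Primrec i) (hΔ : Primrec Δ) :
    Primrec fun a => (P a).update (s a) (i a) (Δ a) := by
  have hm := Primrec.nat_mod.comp hs hP.seeds
  exact Primrec.nat_add.comp hm (Primrec.nat_mul.comp hP.seeds (Primrec.nat_mod.comp
    (Primrec.nat_add.comp (Primrec.nat_div.comp hs hP.seeds)
      (Primrec.nat_mul.comp (Primrec.int_emod_toNat.comp hΔ hP.p) (hP.column hm hi)))
    hP.sketches))

theorem cell {x c : α → ℕ} (hx : Primrec x) (hc : Primrec c) :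
    Primrec fun a => (P a).cell (x a) (c a) :=
  Primrec.nat_mod.comp (Primrec.nat_div.comp hx (Primrec.nat_pow.comp (.const 2)
    (Primrec.nat_mul.comp hP.w hc))) (Primrec.nat_pow.comp (.const 2) hP.w)

theorem accepts {u v : α → ℕ} (hu : Primrec u) (hv : Primrec v) :
    PrimrecPred fun a => (P a).Accepts (u a) (v a) :=
  Primrec.nat_lt.comp (Primrec.nat_pow.comp (Primrec.nat_add.comp (.const 1) hP.V) hu)
    (Primrec.nat_pow.comp (Primrec.nat_add.comp (.const 1) hv) hP.p)

theorem finds {z x ρ j : α → ℕ} (hz : Primrec z) (hx : Primrec x) (hρ : Primrec ρ)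
    (hj : Primrec j) : PrimrecPred fun a => (P a).Finds (z a) (x a) (ρ a) (j a) := by
  have f := Primrec.fst.comp (Primrec.fst (α := α × ℕ) (β := ℕ))
  have k := Primrec.snd.comp (Primrec.fst (α := α × ℕ) (β := ℕ))
  have v := Primrec.snd (α := α × ℕ) (β := ℕ)
  have hP' := hP.comp f
  have hc := hP'.cell (hx.comp f) (Primrec.nat_add.comp
    (Primrec.nat_mul.comp (hρ.comp f) hP'.L) k)
  have hr := Primrec.nat_mul.comp v (Primrec.nat_pow.comp
    (Primrec.nat_mod.comp (hz.comp f) hP'.p) (hj.comp f))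
  refine PrimrecPred.bounded_exists hP.L (PrimrecPred.bounded_exists
    (Primrec.succ.comp (hP.V.comp Primrec.fst)) (PrimrecPred.and (PrimrecPred.and
      (Primrec.nat_lt.comp (.const 0) v) (hP'.accepts ?_ v)) (PrimrecPred.or
      (Primrec.eq.comp (Primrec.nat_mod.comp hc hP'.p) (Primrec.nat_mod.comp hr hP'.p))
      (Primrec.eq.comp (Primrec.nat_mod.comp (Primrec.nat_add.comp hc hr) hP'.p) (.const 0)))))
  exact Primrec.nat_mod.comp (hP'.repSeed (hz.comp f) (hρ.comp f)) hP'.p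

theorem repOut {n z x ρ : α → ℕ} (hn : Primrec n) (hz : Primrec z) (hx : Primrec x)
    (hρ : Primrec ρ) : Primrec fun a => (P a).repOut (n a) (z a) (x a) (ρ a) := by
  classical
  have f := Primrec.fst (α := α) (β := ℕ)
  have s := Primrec.snd (α := α) (β := ℕ)
  exact Primrec.sum_range hn (Primrec.ite ((hP.comp f).finds (hz.comp f) (hx.comp f)
    (hρ.comp f) s) (Primrec.succ.comp s) (.const 0))

theorem answer {n z x : α → ℕ} (hn : Primrec n) (hz : Primrec z) (hx : Primrec x) :
    Primrec fun a => (P a).answer (n a) (z a) (x a) := by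
  have f := Primrec.fst (α := α) (β := ℕ)
  have h := primrec_lastNonzero (f := fun a ρ => (P a).repOut (n a) (z a) (x a) ρ)
    ((hP.comp f).repOut (hn.comp f) (hz.comp f) (hx.comp f) Primrec.snd) hP.R
  exact Primrec.ite (Primrec.eq.comp h (.const 0)) hn (Primrec.nat_sub.comp h (.const 1))

end PrimrecParams

end Primrec

/-- The streaming algorithm with given primitive recursive parameters. -/
noncomputable def sampler (P : ℕ → Params) (hP : PrimrecParams P) (space : ℕ → ℕ)
    (hs : Primrec space) (hpos : ∀ n, 0 < (P n).p)
    (hle : ∀ n, (P n).seeds * (P n).sketches ≤ 2 ^ space n) : StreamingAlgorithm where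
  space := space
  init n w := w % (P n).seeds
  update n s i Δ _ := (P n).update s i Δ
  output n s _ := (P n).answer n (s % (P n).seeds) (s / (P n).seeds)
  init_lt n w := by
    have h1 : 0 < (P n).seeds := Nat.mul_pos (hpos n) (pow_pos (pow_pos (hpos n) _) _)
    have h2 : 0 < (P n).sketches := Nat.two_pow_pos _
    exact (Nat.mod_lt _ h1).trans_le ((Nat.le_mul_of_pos_right _ h2).trans (hle n))
  update_lt n s i Δ w := by
    have h1 : 0 < (P n).seeds := Nat.mul_pos (hpos n) (pow_pos (pow_pos (hpos n) _) _)
    have h2 : 0 < (P n).sketches := Nat.two_pow_pos _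
    refine lt_of_lt_of_le ?_ (hle n)
    calc (P n).update s i Δ < (P n).seeds + (P n).seeds * ((P n).sketches - 1) :=
          Nat.add_lt_add_of_lt_of_le (Nat.mod_lt _ h1)
            (Nat.mul_le_mul_left _ (Nat.le_sub_one_of_lt (Nat.mod_lt _ h2)))
      _ = (P n).seeds * (P n).sketches := by
          obtain ⟨k, hk⟩ := Nat.exists_eq_add_of_lt h2
          rw [hk]; simp; ring
  computable_space := hs.to_comp
  computable_init := (Primrec.nat_mod.comp Primrec.snd (hP.comp Primrec.fst).seeds).to_comp
  computable_update := by
    have s2 := Primrec.snd (α := ℕ) (β := ℕ × ℕ × ℤ × ℕ)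
    exact ((hP.comp Primrec.fst).update (Primrec.fst.comp s2)
      (Primrec.fst.comp (Primrec.snd.comp s2))
      (Primrec.fst.comp (Primrec.snd.comp (Primrec.snd.comp s2)))).to_comp
  computable_output := by
    have hP' := hP.comp (Primrec.fst (α := ℕ) (β := ℕ × ℕ))
    have s := Primrec.fst.comp (Primrec.snd (α := ℕ) (β := ℕ × ℕ))
    exact (hP'.answer Primrec.fst (Primrec.nat_mod.comp s hP'.seeds)
      (Primrec.nat_div.comp s hP'.seeds)).to_comp

end LogSampler

/-! ### Probabilities under the uniform law on an initial segment of the naturals -/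

section RangeProb

open Finset

open Classical in
/-- The indicator of a proposition. -/
noncomputable def propInd (a : Prop) : ℝ := if a then 1 else 0

theorem propInd_true {a : Prop} (h : a) : propInd a = 1 := if_pos h

theorem propInd_false {a : Prop} (h : ¬a) : propInd a = 0 := if_neg h

theorem propInd_nonneg (a : Prop) : 0 ≤ propInd a := by
  unfold propInd; split_ifs <;> norm_num

theorem propInd_le_one (a : Prop) : propInd a ≤ 1 := by
  unfold propInd; split_ifs <;> norm_num

theorem propInd_and (a b : Prop) : propInd (a ∧ b) = propInd a * propInd b := by
  by_cases ha : a <;> by_cases hb : b <;> simp [propInd, ha, hb]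

theorem propInd_mono {a b : Prop} (h : a → b) : propInd a ≤ propInd b := by
  by_cases ha : a
  · rw [propInd_true ha, propInd_true (h ha)]
  · rw [propInd_false ha]; exact propInd_nonneg b

theorem propInd_forall {ι : Type*} (A : Finset ι) (E : ι → Prop) :
    propInd (∀ i ∈ A, E i) = ∏ i ∈ A, propInd (E i) := by
  classical
  by_cases h : ∀ i ∈ A, E i
  · rw [propInd_true h, prod_eq_one fun i hi => propInd_true (h i hi)]
  · rw [propInd_false h]
    push Not at h
    obtain ⟨i, hi, hE⟩ := h
    exact (prod_eq_zero hi (propInd_false hE)).symm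

theorem sum_propInd {ι : Type*} (A : Finset ι) (E : ι → Prop) [DecidablePred E] :
    ∑ i ∈ A, propInd (E i) = #{i ∈ A | E i} := by
  rw [← sum_boole]
  exact sum_congr rfl fun i _ => by by_cases h : E i <;> simp [propInd, h]

/-- The mean of `f` under the uniform law on `{0, …, N - 1}`. -/
noncomputable def rangeMean (N : ℕ) (f : ℕ → ℝ) : ℝ := (∑ x ∈ range N, f x) / N

/-- The probability of `E` under the uniform law on `{0, …, N - 1}`. -/
noncomputable def rangeProb (N : ℕ) (E : ℕ → Prop) : ℝ := rangeMean N fun x => propInd (E x)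

theorem rangeMean_congr {N : ℕ} {f g : ℕ → ℝ} (h : ∀ x < N, f x = g x) :
    rangeMean N f = rangeMean N g := by
  rw [rangeMean, rangeMean, sum_congr rfl fun x hx => h x (mem_range.1 hx)]

theorem rangeMean_mono {N : ℕ} {f g : ℕ → ℝ} (h : ∀ x < N, f x ≤ g x) :
    rangeMean N f ≤ rangeMean N g :=
  div_le_div_of_nonneg_right (sum_le_sum fun x hx => h x (mem_range.1 hx)) (Nat.cast_nonneg N)

theorem rangeMean_add (N : ℕ) (f g : ℕ → ℝ) :
    rangeMean N (fun x => f x + g x) = rangeMean N f + rangeMean N g := by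
  rw [rangeMean, sum_add_distrib, add_div]; rfl

theorem rangeMean_sub (N : ℕ) (f g : ℕ → ℝ) :
    rangeMean N (fun x => f x - g x) = rangeMean N f - rangeMean N g := by
  rw [rangeMean, sum_sub_distrib, sub_div]; rfl

theorem rangeMean_const_mul (N : ℕ) (c : ℝ) (f : ℕ → ℝ) :
    rangeMean N (fun x => c * f x) = c * rangeMean N f := by
  rw [rangeMean, ← mul_sum, mul_div_assoc]; rfl

theorem rangeMean_mul_const (N : ℕ) (c : ℝ) (f : ℕ → ℝ) :
    rangeMean N (fun x => f x * c) = rangeMean N f * c := by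
  simp only [mul_comm _ c, rangeMean_const_mul]

theorem rangeMean_sum {ι : Type*} (N : ℕ) (A : Finset ι) (f : ι → ℕ → ℝ) :
    rangeMean N (fun x => ∑ i ∈ A, f i x) = ∑ i ∈ A, rangeMean N (f i) := by
  rw [rangeMean, sum_comm, sum_div]; rfl

theorem rangeMean_const {N : ℕ} (hN : 0 < N) (c : ℝ) : rangeMean N (fun _ => c) = c := by
  have : (N : ℝ) ≠ 0 := by exact_mod_cast hN.ne'
  rw [rangeMean, sum_const, card_range, nsmul_eq_mul, mul_div_cancel_left₀ _ this]

theorem abs_rangeMean_le (N : ℕ) (f : ℕ → ℝ) : |rangeMean N f| ≤ rangeMean N fun x => |f x| := by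
  rw [rangeMean, abs_div, Nat.abs_cast]
  exact div_le_div_of_nonneg_right (abs_sum_le_sum_abs _ _) (Nat.cast_nonneg N)

theorem rangeProb_congr {N : ℕ} {E F : ℕ → Prop} (h : ∀ x < N, (E x ↔ F x)) :
    rangeProb N E = rangeProb N F :=
  rangeMean_congr fun x hx => by rw [propext (h x hx)]

theorem rangeProb_nonneg (N : ℕ) (E : ℕ → Prop) : 0 ≤ rangeProb N E :=
  div_nonneg (sum_nonneg fun _ _ => propInd_nonneg _) (Nat.cast_nonneg N)

theorem rangeProb_mono {N : ℕ} {E F : ℕ → Prop} (h : ∀ x < N, E x → F x) :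
    rangeProb N E ≤ rangeProb N F :=
  rangeMean_mono fun x hx => propInd_mono (h x hx)

theorem rangeProb_of_forall {N : ℕ} (hN : 0 < N) {E : ℕ → Prop} (h : ∀ x < N, E x) :
    rangeProb N E = 1 := by
  rw [rangeProb, rangeMean_congr fun x hx => propInd_true (h x hx), rangeMean_const hN]

theorem rangeProb_eq_zero {N : ℕ} {E : ℕ → Prop} (h : ∀ x < N, ¬E x) : rangeProb N E = 0 := by
  rw [rangeProb, rangeMean_congr fun x hx => propInd_false (h x hx)]
  simp [rangeMean]

theorem rangeProb_le_one (N : ℕ) (E : ℕ → Prop) : rangeProb N E ≤ 1 := by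
  rcases Nat.eq_zero_or_pos N with rfl | hN
  · simp [rangeProb, rangeMean]
  · exact (rangeProb_mono fun _ _ _ => trivial).trans
      (rangeProb_of_forall hN fun _ _ => trivial).le

theorem rangeProb_not {N : ℕ} (hN : 0 < N) (E : ℕ → Prop) :
    rangeProb N (fun x => ¬E x) = 1 - rangeProb N E := by
  rw [rangeProb, rangeProb, ← rangeMean_const hN 1, ← rangeMean_sub]
  refine rangeMean_congr fun x _ => ?_
  by_cases h : E x <;> simp [propInd, h]

theorem sum_range_mul {M : Type*} [AddCommMonoid M] (a b : ℕ) (f : ℕ → M) :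
    ∑ x ∈ range (a * b), f x = ∑ y ∈ range b, ∑ x ∈ range a, f (x + a * y) := by
  induction b with
  | zero => simp
  | succ b ih =>
    rw [Nat.mul_succ, sum_range_add, ih, sum_range_succ]
    simp only [add_comm]

theorem rangeMean_mul (a b : ℕ) (f : ℕ → ℝ) :
    rangeMean (a * b) f = rangeMean b fun y => rangeMean a fun x => f (x + a * y) := by
  simp only [rangeMean]
  rw [sum_range_mul, Nat.cast_mul, ← sum_div, div_div]

/-- Reducing a uniform number below `W` modulo `N` gives a nearly uniform number below `N`. -/
theorem abs_rangeProb_mod_sub_le {N W : ℕ} (hN : 0 < N) (hNW : N ≤ W) (E : ℕ → Prop) :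
    |rangeProb W (fun x => E (x % N)) - rangeProb N E| ≤ (N : ℝ) / W := by
  have hW : (0 : ℝ) < W := by exact_mod_cast hN.trans_le hNW
  have hN' : (0 : ℝ) < N := by exact_mod_cast hN
  set k := W / N
  set r := W % N
  have hWk : W = N * k + r := (Nat.div_add_mod W N).symm
  have hr : r < N := Nat.mod_lt _ hN
  -- The residues run through k full periods and r < N further values; only the incomplete period
  -- causes a bias.
  have h1 : ∑ x ∈ range W, propInd (E (x % N)) =
      k * ∑ x ∈ range N, propInd (E x) + ∑ x ∈ range r, propInd (E x) := by
    rw [hWk, sum_range_add, sum_range_mul]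
    congr 1
    · rw [← nsmul_eq_mul, ← card_range k, ← sum_const, card_range]
      refine sum_congr rfl fun y _ => sum_congr rfl fun x hx => ?_
      rw [Nat.add_mul_mod_self_left, Nat.mod_eq_of_lt (mem_range.1 hx)]
    · refine sum_congr rfl fun x hx => ?_
      rw [Nat.mul_add_mod, Nat.mod_eq_of_lt ((mem_range.1 hx).trans hr)]
  have hS0 : 0 ≤ ∑ x ∈ range N, propInd (E x) := sum_nonneg fun _ _ => propInd_nonneg _
  have hT0 : 0 ≤ ∑ x ∈ range r, propInd (E x) := sum_nonneg fun _ _ => propInd_nonneg _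
  have hT1 : ∑ x ∈ range r, propInd (E x) ≤ r := by
    simpa using sum_le_sum (s := range r) fun x _ => propInd_le_one (E x)
  have hS1 : (∑ x ∈ range N, propInd (E x)) / N ≤ 1 := rangeProb_le_one N E
  have hS2 := div_nonneg hS0 hN'.le
  have hr' : (r : ℝ) ≤ N := by exact_mod_cast hr.le
  have hWr : (W : ℝ) = N * k + r := by exact_mod_cast hWk
  have key : rangeProb W (fun x => E (x % N)) - rangeProb N E =
      (∑ x ∈ range r, propInd (E x) - r * ((∑ x ∈ range N, propInd (E x)) / N)) / W := by
    rw [rangeProb, rangeProb, rangeMean, rangeMean, h1, eq_div_iff hW.ne', sub_mul,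
      div_mul_cancel₀ _ hW.ne', hWr]
    field_simp
    ring
  rw [key, abs_div, abs_of_pos hW]
  refine div_le_div_of_nonneg_right ?_ hW.le
  have hr0 : (0 : ℝ) ≤ r := Nat.cast_nonneg r
  rw [abs_le]
  constructor <;> nlinarith

end RangeProb

/-! ### Independence of the values of a random polynomial -/

namespace LogSampler

open Finset

theorem polyHash_lt {p : ℕ} (hp : 0 < p) (t y i : ℕ) : polyHash p t y i < p := Nat.mod_lt _ hp

/-- Two polynomials of degree below t that agree at t distinct points of F_p coincide, and `y` is
recovered from its base-`p` digits, which are the coefficients. -/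
theorem polyHash_injective {p t : ℕ} [Fact p.Prime] {A : Finset ℕ} (hA : ∀ i ∈ A, i < p)
    (hAt : #A = t) {y y' : ℕ} (hy : y < p ^ t) (hy' : y' < p ^ t)
    (h : ∀ i ∈ A, polyHash p t y i = polyHash p t y' i) : y = y' := by
  have hp : 0 < p := (Fact.out : p.Prime).pos
  let f : ℕ → Polynomial (ZMod p) := fun y =>
    ∑ e ∈ range t, Polynomial.C ((y / p ^ e % p : ℕ) : ZMod p) * Polynomial.X ^ e
  have hdeg : ∀ y, (f y).degree < (#A : WithBot ℕ) := by
    intro y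
    rw [hAt, ← Polynomial.mem_degreeLT]
    refine Submodule.sum_mem _ fun e he => Polynomial.mem_degreeLT.2 ?_
    exact (Polynomial.degree_C_mul_X_pow_le _ _).trans_lt (by exact_mod_cast mem_range.1 he)
  have heval : ∀ y i : ℕ, (f y).eval (i : ZMod p) = (polyHash p t y i : ZMod p) := by
    intro y i
    simp [f, polyHash, Polynomial.eval_finsetSum]
  have hf : f y = f y' := by
    refine Polynomial.eq_of_degrees_lt_of_eval_index_eq A (v := fun i : ℕ => (i : ZMod p))
      (fun i hi j hj hij => ?_) (hdeg y) (hdeg y') fun i hi => ?_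
    · rwa [ZMod.natCast_eq_natCast_iff', Nat.mod_eq_of_lt (hA i hi),
        Nat.mod_eq_of_lt (hA j hj)] at hij
    · rw [heval, heval, h i hi]
  have hcoeff : ∀ y, ∀ e < t, (f y).coeff e = ((y / p ^ e % p : ℕ) : ZMod p) := by
    intro y e he
    simp [f, Polynomial.coeff_X_pow, he]
  have hfin : finFunctionFinEquiv.symm (⟨y, hy⟩ : Fin (p ^ t)) =
      finFunctionFinEquiv.symm ⟨y', hy'⟩ := by
    funext e
    have h1 : ((y / p ^ (e : ℕ) % p : ℕ) : ZMod p) = ((y' / p ^ (e : ℕ) % p : ℕ) : ZMod p) := by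
      rw [← hcoeff y e e.2, ← hcoeff y' e e.2, hf]
    rw [ZMod.natCast_eq_natCast_iff', Nat.mod_mod, Nat.mod_mod] at h1
    exact Fin.ext h1
  exact Fin.mk.inj_iff.1 (finFunctionFinEquiv.symm.injective hfin)

/-- By injectivity and equality of cardinals, evaluation on `A` is a bijection from the seeds onto
all functions from `A` to F_p, so the values are exactly independent and uniform. -/
theorem rangeProb_polyHash_of_card_eq {p t : ℕ} [Fact p.Prime] {A : Finset ℕ}
    (hA : ∀ i ∈ A, i < p) (hAt : #A = t) (E : ℕ → ℕ → Prop) :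
    rangeProb (p ^ t) (fun y => ∀ i ∈ A, E i (polyHash p t y i)) =
      ∏ i ∈ A, rangeProb p (E i) := by
  have hp : 0 < p := (Fact.out : p.Prime).pos
  let Φ : Fin (p ^ t) → A → Fin p := fun y i => ⟨polyHash p t y i, polyHash_lt hp _ _ _⟩
  have hΦ : Function.Bijective Φ := by
    rw [Fintype.bijective_iff_injective_and_card]
    refine ⟨fun y y' h => Fin.ext (polyHash_injective hA hAt y.2 y'.2 fun i hi => ?_), ?_⟩
    · exact Fin.mk.inj_iff.1 (congrFun h ⟨i, hi⟩)
    · simp [hAt]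
  have h1 : ∑ y ∈ range (p ^ t), propInd (∀ i ∈ A, E i (polyHash p t y i)) =
      ∏ i ∈ A, ∑ z ∈ range p, propInd (E i z) := by
    rw [← Fin.sum_univ_eq_sum_range
      (fun y => propInd (∀ i ∈ A, E i (polyHash p t y i))), ← prod_coe_sort]
    simp only [← Fin.sum_univ_eq_sum_range]
    rw [prod_univ_sum, Fintype.piFinset_univ, ← Function.Bijective.sum_comp hΦ
      (fun g => ∏ i : A, propInd (E i (g i)))]
    refine sum_congr rfl fun y _ => ?_
    rw [propInd_forall, ← prod_coe_sort]
  rw [rangeProb, rangeMean, h1]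
  simp only [rangeProb, rangeMean]
  rw [prod_div_distrib, prod_const, hAt, Nat.cast_pow]

/-- The values of a random polynomial with `t` coefficients are `t`-wise independent. -/
theorem rangeProb_polyHash {p t : ℕ} [Fact p.Prime] (htp : t ≤ p) {A : Finset ℕ}
    (hA : ∀ i ∈ A, i < p) (hAt : #A ≤ t) (E : ℕ → ℕ → Prop) :
    rangeProb (p ^ t) (fun y => ∀ i ∈ A, E i (polyHash p t y i)) =
      ∏ i ∈ A, rangeProb p (E i) := by
  have hp : 0 < p := (Fact.out : p.Prime).pos
  -- Pad `A` to exactly t points; the added points carry vacuous events, which contribute factors 1.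
  obtain ⟨B, hAB, hB, hBt⟩ := exists_subsuperset_card_eq
    (fun i hi => mem_range.2 (hA i hi)) hAt (by rwa [card_range])
  have h := rangeProb_polyHash_of_card_eq (fun i hi => mem_range.1 (hB hi)) hBt
    (fun i z => i ∈ A → E i z)
  rw [← prod_subset hAB fun i _ hi => rangeProb_of_forall hp fun _ _ h => absurd h hi] at h
  refine Eq.trans (rangeProb_congr fun y _ => ?_) (h.trans (prod_congr rfl fun i hi =>
    rangeProb_congr fun z _ => by simp [hi]))
  exact ⟨fun h i _ hi => h i hi, fun h i hi => h i (hAB hi) hi⟩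

/-! ### Truncated inclusion-exclusion under limited independence. -/

/-- Bonferroni's inequalities for one number of events. -/
theorem abs_ind_sub_alternating_sum_le (Z m : ℕ) :
    |propInd (Z = 0) - ∑ i ∈ range (m + 1), (-1 : ℝ) ^ i * Z.choose i| ≤ Z.choose m := by
  rcases Z with _ | Z
  · rw [propInd_true rfl, sum_range_succ']
    simp
  · have h : ∑ i ∈ range (m + 1), (-1 : ℝ) ^ i * (Z + 1).choose i = (-1) ^ m * Z.choose m := by
      exact_mod_cast Int.alternating_sum_range_choose_eq_choose (n := Z) (m := m)
    rw [propInd_false Z.succ_ne_zero, h, zero_sub, abs_neg, abs_mul, abs_pow, abs_neg, abs_one,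
      one_pow, one_mul, Nat.abs_cast]
    exact_mod_cast Nat.choose_le_choose m Z.le_succ

/-- The alternating sum that approximates the probability that none of `s` independent events of
probability `τ` happens. -/
noncomputable def bonferroni (s m : ℕ) (τ : ℝ) : ℝ :=
  ∑ i ∈ range (m + 1), (-1 : ℝ) ^ i * (s.choose i * τ ^ i)

/-- Take the mean of Bonferroni's inequality for the number `Z` of indices in `A` with `F`, weighted
by the indicator of `E` at `j`. The binomial of `Z` over i counts the i-subsets of `A` on which `F`
holds; with `j` added such a set has at most m + 1 ≤ t elements, so t-wise independence evaluates
every term exactly. -/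
theorem abs_rangeProb_sub_bonferroni_le {p t m : ℕ} [Fact p.Prime] (htp : t ≤ p) (hmt : m < t)
    {j : ℕ} {A : Finset ℕ} (hjp : j < p) (hA : ∀ i ∈ A, i < p) (hj : j ∉ A) (E F : ℕ → Prop) :
    |rangeProb (p ^ t) (fun y => E (polyHash p t y j) ∧ ∀ i ∈ A, ¬F (polyHash p t y i)) -
        rangeProb p E * bonferroni #A m (rangeProb p F)| ≤
      rangeProb p E * (((#A).choose m : ℝ) * rangeProb p F ^ m) := by
  classical
  set Z : ℕ → ℕ := fun y => #{i ∈ A | F (polyHash p t y i)}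
  set e : ℕ → ℝ := fun y => propInd (E (polyHash p t y j))
  have hmean : ∀ i ≤ m, rangeMean (p ^ t) (fun y => e y * (Z y).choose i) =
      rangeProb p E * ((#A).choose i * rangeProb p F ^ i) := by
    intro i hi
    have h1 : ∀ y, e y * (Z y).choose i = ∑ B ∈ powersetCard i A,
        propInd (∀ l ∈ insert j B, if l = j then E (polyHash p t y l)
          else F (polyHash p t y l)) := by
      intro y
      have h2 : ((Z y).choose i : ℝ) = ∑ B ∈ powersetCard i A,
          propInd (∀ l ∈ B, F (polyHash p t y l)) := by
        rw [← card_powersetCard]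
        rw [sum_propInd]
        congr 2
        ext B
        simp only [mem_powersetCard, mem_filter, subset_iff]
        constructor
        · rintro ⟨h, h'⟩
          exact ⟨⟨fun x hx => (h hx).1, h'⟩, fun x hx => (h hx).2⟩
        · rintro ⟨⟨h, h'⟩, h''⟩
          exact ⟨fun x hx => ⟨h hx, h'' x hx⟩, h'⟩
      rw [h2, mul_sum]
      refine sum_congr rfl fun B hB => ?_
      rw [← propInd_and]
      congr 1
      have hjB : ∀ l ∈ B, l ≠ j := fun l hl h => hj (h ▸ (mem_powersetCard.1 hB).1 hl)
      rw [eq_iff_iff, forall_mem_insert, if_pos rfl]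
      exact and_congr_right fun _ => forall₂_congr fun l hl => by rw [if_neg (hjB l hl)]
    simp only [h1]
    rw [rangeMean_sum]
    have h3 : ∀ B ∈ powersetCard i A, rangeMean (p ^ t) (fun y => propInd (∀ l ∈ insert j B,
        if l = j then E (polyHash p t y l) else F (polyHash p t y l))) =
        rangeProb p E * rangeProb p F ^ i := by
      intro B hB
      obtain ⟨hBA, hBi⟩ := mem_powersetCard.1 hB
      have hjB : j ∉ B := fun h => hj (hBA h)
      have := rangeProb_polyHash htp (A := insert j B) (p := p) (t := t)
        (by
          intro l hl
          rcases mem_insert.1 hl with rfl | hl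
          · exact hjp
          · exact hA l (hBA hl))
        (by rw [card_insert_of_notMem hjB]; omega) (fun l z => if l = j then E z else F z)
      rw [rangeProb] at this
      rw [this, prod_insert hjB]
      simp only [if_true]
      congr 1
      rw [← hBi, ← prod_const]
      refine prod_congr rfl fun l hl => ?_
      have : l ≠ j := fun h => hjB (h ▸ hl)
      simp only [this, if_false]
    rw [sum_congr rfl h3, sum_const, card_powersetCard, nsmul_eq_mul]
    ring
  have hsum : rangeProb p E * bonferroni #A m (rangeProb p F) =
      rangeMean (p ^ t) fun y => e y * ∑ i ∈ range (m + 1), (-1 : ℝ) ^ i * (Z y).choose i := by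
    rw [bonferroni, mul_sum]
    simp only [mul_sum]
    rw [rangeMean_sum]
    refine sum_congr rfl fun i hi => ?_
    have := hmean i (Nat.lt_succ_iff.1 (mem_range.1 hi))
    simp only [mul_left_comm (e _)]
    rw [rangeMean_const_mul, this]
    ring
  rw [hsum, ← hmean m le_rfl, rangeProb, ← rangeMean_sub]
  refine (abs_rangeMean_le _ _).trans (rangeMean_mono fun y _ => ?_)
  have h4 : propInd (E (polyHash p t y j) ∧ ∀ i ∈ A, ¬F (polyHash p t y i)) =
      e y * propInd (Z y = 0) := by
    rw [propInd_and]
    congr 2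
    rw [eq_iff_iff, card_eq_zero, filter_eq_empty_iff]
  have he : 0 ≤ e y := propInd_nonneg _
  rw [h4, ← mul_sub, abs_mul, abs_of_nonneg he]
  exact mul_le_mul_of_nonneg_left (abs_ind_sub_alternating_sum_le _ _) he

end LogSampler

namespace LogSampler

open Finset

/-! ### Isolating an index by its subsampling level -/

/-- The deepest of the levels `0, …, L - 1` to which an index with hash value `y` belongs. -/
def level (p L y : ℕ) : ℕ := Nat.findGreatest (fun k => y * 2 ^ k < p) (L - 1)

theorem le_level_iff {p L y k : ℕ} (hk : k < L) (hy : y < p) :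
    k ≤ level p L y ↔ y * 2 ^ k < p := by
  constructor
  · intro h
    have h0 : y * 2 ^ level p L y < p :=
      Nat.findGreatest_spec (P := fun k => y * 2 ^ k < p) (Nat.zero_le (L - 1)) (by simpa using hy)
    exact (Nat.mul_le_mul_left y (Nat.pow_le_pow_right two_pos h)).trans_lt h0
  · exact fun h => Nat.le_findGreatest (by omega) h

theorem level_lt {p L : ℕ} (hL : 0 < L) (y : ℕ) : level p L y < L := by
  have := Nat.findGreatest_le (P := fun k => y * 2 ^ k < p) (L - 1)
  unfold level
  omega

/-- The probability of belonging to level `k`. -/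
noncomputable def levelProb (p L k : ℕ) : ℝ := rangeProb p fun y => k ≤ level p L y

theorem levelProb_eq {p L k : ℕ} (hp : 0 < p) (hk : k < L) :
    levelProb p L k = (((p - 1) / 2 ^ k + 1 : ℕ) : ℝ) / p := by
  rw [levelProb, rangeProb, rangeMean, sum_propInd]
  congr 2
  rw [← card_range ((p - 1) / 2 ^ k + 1)]
  congr 1
  ext y
  rw [mem_filter, mem_range, mem_range, Nat.lt_succ_iff, Nat.le_div_iff_mul_le (by positivity)]
  constructor
  · rintro ⟨h1, h2⟩
    have := (le_level_iff hk h1).1 h2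
    omega
  · intro h
    have h1 : y ≤ y * 2 ^ k := Nat.le_mul_of_pos_right y (by positivity)
    exact ⟨by omega, (le_level_iff hk (by omega)).2 (by omega)⟩

theorem levelProb_nonneg (p L k : ℕ) : 0 ≤ levelProb p L k := rangeProb_nonneg _ _

theorem levelProb_le_one (p L k : ℕ) : levelProb p L k ≤ 1 := rangeProb_le_one _ _

theorem levelProb_anti {p L k l : ℕ} (h : k ≤ l) : levelProb p L l ≤ levelProb p L k :=
  rangeProb_mono fun _ _ h' => h.trans h'

theorem levelProb_zero {p L : ℕ} (hp : 0 < p) : levelProb p L 0 = 1 :=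
  rangeProb_of_forall hp fun _ _ => Nat.zero_le _

/-- Rounding does no harm: a floor is at most twice the floor of its half, plus 1. Hence expected
level sizes cannot jump over a window of ratio 2. -/
theorem levelProb_le_two_mul {p L k : ℕ} (hp : 0 < p) (hk : k + 1 < L) :
    levelProb p L k ≤ 2 * levelProb p L (k + 1) := by
  rw [levelProb_eq hp (by omega), levelProb_eq hp hk, ← mul_div_assoc]
  refine div_le_div_of_nonneg_right ?_ (Nat.cast_nonneg p)
  rw [pow_succ, ← Nat.div_div_eq_div_mul]
  exact_mod_cast (by omega : (p - 1) / 2 ^ k + 1 ≤ 2 * ((p - 1) / 2 ^ k / 2 + 1))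

theorem levelProb_last_le {p L : ℕ} (hp : 0 < p) (hL : 0 < L) :
    levelProb p L (L - 1) ≤ 1 / 2 ^ (L - 1) + 1 / p := by
  have hp' : (0 : ℝ) < p := by exact_mod_cast hp
  rw [levelProb_eq hp (by omega), div_le_iff₀ hp', add_mul, one_div_mul_cancel hp'.ne',
    Nat.cast_add, Nat.cast_one, one_div_mul_eq_div]
  refine add_le_add_left (Nat.cast_div_le.trans ?_) 1
  push_cast
  exact div_le_div_of_nonneg_right (by exact_mod_cast Nat.sub_le p 1) (by positivity)

/-- If level `0` has more than `θ` members in expectation and the last level at most `θ`, then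
some level has between `θ / 2` and `θ`. -/
theorem exists_level_between {p L : ℕ} (hp : 0 < p) (hL : 0 < L) {s θ : ℝ} (hs : 0 ≤ s)
    (h0 : θ < s) (hlast : s * levelProb p L (L - 1) ≤ θ) :
    ∃ k < L, s * levelProb p L k ≤ θ ∧ θ / 2 < s * levelProb p L k ∧
      ∀ l, θ < s * levelProb p L l → l < k := by
  classical
  -- Take the first level of expected size at most θ. It is not level 0, and the level before it
  -- exceeds θ, so its own size exceeds θ / 2.
  have hex : ∃ k, s * levelProb p L k ≤ θ := ⟨L - 1, hlast⟩
  have hle := Nat.find_min' hex hlast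
  refine ⟨Nat.find hex, by omega, Nat.find_spec hex, ?_, fun l hl => ?_⟩
  · obtain ⟨k, hk⟩ : ∃ k, Nat.find hex = k + 1 := by
      refine Nat.exists_eq_succ_of_ne_zero fun h => ?_
      have := Nat.find_spec hex
      rw [h, levelProb_zero hp] at this
      linarith
    have h1 := Nat.find_min hex (by omega : k < Nat.find hex)
    have h2 := levelProb_le_two_mul (L := L) hp (by omega : k + 1 < L)
    rw [hk]
    nlinarith
  · by_contra h
    have := mul_le_mul_of_nonneg_left (levelProb_anti (p := p) (L := L) (not_lt.1 h)) hs
    have := Nat.find_spec hex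
    linarith

/-- The left side is at most (sτ)^m / m! ≤ (m/8)^m / m!, and m^m / m! ≤ e^m. The constant 8 is
chosen so that e/8 < 1/2. -/
theorem choose_mul_pow_le {s m : ℕ} {τ : ℝ} (hτ : 0 ≤ τ) (h : s * τ ≤ m / 8) :
    (s.choose m : ℝ) * τ ^ m ≤ (1 / 2) ^ m := by
  have hm : (0 : ℝ) < m.factorial := by exact_mod_cast m.factorial_pos
  calc (s.choose m : ℝ) * τ ^ m ≤ s ^ m / m.factorial * τ ^ m :=
        mul_le_mul_of_nonneg_right (Nat.choose_le_pow_div m s) (pow_nonneg hτ m)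
    _ = (s * τ) ^ m / m.factorial := by rw [mul_pow]; ring
    _ ≤ (m / 8) ^ m / m.factorial := by gcongr
    _ = (m : ℝ) ^ m / m.factorial * (1 / 8) ^ m := by rw [div_pow, div_pow]; ring
    _ ≤ Real.exp m * (1 / 8) ^ m := by
        gcongr
        exact Real.pow_div_factorial_le_exp _ (Nat.cast_nonneg m) m
    _ = (Real.exp 1 * (1 / 8)) ^ m := by rw [mul_pow, ← Real.exp_nat_mul, mul_one]
    _ ≤ (1 / 2) ^ m := by
        have := Real.exp_one_lt_d9
        have := Real.exp_pos 1
        gcongr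
        linarith

/-- The alternating sum does not depend on the number of coefficients of the hash, so it may be
compared with the case of p coefficients, where all values are independent. There the probability it
approximates is (1 - τ)^s ≤ exp(-sτ) ≤ exp(-m/16). -/
theorem bonferroni_le {p m : ℕ} [Fact p.Prime] (hm : m < p) {A : Finset ℕ}
    (hA : ∀ i ∈ A, i < p) {j : ℕ} (hj : j < p) (hjA : j ∉ A) (F : ℕ → Prop)
    (h : #A * rangeProb p F ≤ m / 8) (h' : (m : ℝ) / 16 ≤ #A * rangeProb p F) :
    bonferroni #A m (rangeProb p F) ≤ Real.exp (-(m / 16)) + (1 / 2) ^ m := by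
  have hp : 0 < p := (Fact.out : p.Prime).pos
  have h1 := abs_rangeProb_sub_bonferroni_le le_rfl hm hj hA hjA (fun _ => True) F
  rw [rangeProb_of_forall hp fun _ _ => trivial, one_mul, one_mul] at h1
  have h2 : #A ≤ p := by
    simpa using card_le_card (fun i hi => mem_range.2 (hA i hi) : A ⊆ range p)
  have h3 : rangeProb (p ^ p) (fun y => True ∧ ∀ i ∈ A, ¬F (polyHash p p y i)) =
      (1 - rangeProb p F) ^ #A := by
    simp only [true_and]
    rw [rangeProb_polyHash le_rfl hA h2 (fun _ z => ¬F z), prod_const, rangeProb_not hp]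
  have h4 : (1 - rangeProb p F) ^ #A ≤ Real.exp (-(m / 16)) := by
    have h5 : 1 - rangeProb p F ≤ Real.exp (-rangeProb p F) := by
      have := Real.add_one_le_exp (-rangeProb p F)
      linarith
    calc (1 - rangeProb p F) ^ #A ≤ Real.exp (-rangeProb p F) ^ #A :=
          pow_le_pow_left₀ (sub_nonneg.2 (rangeProb_le_one _ _)) h5 _
      _ = Real.exp (#A * -rangeProb p F) := (Real.exp_nat_mul _ _).symm
      _ ≤ Real.exp (-(m / 16)) := Real.exp_le_exp.2 (by linarith)
  have h6 := choose_mul_pow_le (rangeProb_nonneg p F) h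
  rw [h3] at h1
  have := (abs_le.1 h1).1
  linarith

/-- The polynomial with coefficients `y` puts `j` into a deeper level than any other index of
`S`. -/
def Isolates (p L t : ℕ) (S : Finset ℕ) (y j : ℕ) : Prop :=
  ∀ i ∈ S.erase j, level p L (polyHash p t y i) < level p L (polyHash p t y j)

/-- The probability that `j` is isolated. -/
noncomputable def isolateProb (p L t : ℕ) (S : Finset ℕ) (j : ℕ) : ℝ :=
  rangeProb (p ^ t) fun y => Isolates p L t S y j

/-- The probability that `j` is isolated and has level `k`. -/
noncomputable def isolateAtProb (p L t : ℕ) (S : Finset ℕ) (k j : ℕ) : ℝ :=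
  rangeProb (p ^ t) fun y => level p L (polyHash p t y j) = k ∧
    ∀ i ∈ S.erase j, ¬k ≤ level p L (polyHash p t y i)

theorem isolateProb_eq_sum {p L : ℕ} (hL : 0 < L) (t : ℕ) (S : Finset ℕ) (j : ℕ) :
    isolateProb p L t S j = ∑ k ∈ range L, isolateAtProb p L t S k j := by
  simp only [isolateProb, isolateAtProb, rangeProb]
  rw [← rangeMean_sum]
  refine rangeMean_congr fun y _ => ?_
  rw [sum_eq_single_of_mem _ (mem_range.2 (level_lt hL (polyHash p t y j)))
    fun k _ hk => propInd_false fun h => hk h.1.symm]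
  congr 1
  simp [Isolates]

section

variable {p L t m : ℕ} [Fact p.Prime] {S : Finset ℕ}

/-- Both probabilities are close to one expression in the size of `S` when at most m/8 competitors
are expected in level k, and both are tiny otherwise. -/
theorem abs_isolateAtProb_sub_le (hL : 0 < L) (htp : t ≤ p) (hmt : m < t) (hm : 2 ≤ m)
    (hS : ∀ i ∈ S, i < p) (hlast : (#S : ℝ) * levelProb p L (L - 1) ≤ 1 / 4) {i j : ℕ}
    (hi : i ∈ S) (hj : j ∈ S) (k : ℕ) :
    |isolateAtProb p L t S k i - isolateAtProb p L t S k j| ≤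
      Real.exp (-(m / 16)) + 2 * (1 / 2) ^ m := by
  have hp : 0 < p := (Fact.out : p.Prime).pos
  have hcard : ∀ l ∈ S, #(S.erase l) = #S - 1 := fun l hl => card_erase_of_mem hl
  have hS' : ∀ l, ∀ i ∈ S.erase l, i < p := fun l i hi => hS i (mem_of_mem_erase hi)
  have hpow : (0 : ℝ) ≤ (1 / 2) ^ m := by positivity
  have hexp := Real.exp_pos (-(m / 16 : ℝ))
  have hm' : (2 : ℝ) ≤ m := by exact_mod_cast hm
  rcases le_or_gt (((#S - 1 : ℕ) : ℝ) * levelProb p L k) (m / 8) with hk | hk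
  · have key : ∀ l ∈ S, |isolateAtProb p L t S k l - rangeProb p (fun y => level p L y = k) *
        bonferroni (#S - 1) m (levelProb p L k)| ≤ (1 / 2) ^ m := by
      intro l hl
      have h := abs_rangeProb_sub_bonferroni_le htp hmt (hS l hl) (hS' l)
        (notMem_erase l S) (fun y => level p L y = k) (fun y => k ≤ level p L y)
      rw [hcard l hl] at h
      refine h.trans ((mul_le_of_le_one_left ?_ (rangeProb_le_one _ _)).trans
        (choose_mul_pow_le (levelProb_nonneg p L k) hk))
      exact mul_nonneg (Nat.cast_nonneg _) (pow_nonneg (rangeProb_nonneg _ _) m)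
    have h1 := abs_le.1 (key i hi)
    have h2 := abs_le.1 (key j hj)
    rw [abs_le]
    constructor <;> linarith
  · have hsub : ((#S - 1 : ℕ) : ℝ) ≤ #S := by exact_mod_cast Nat.sub_le _ _
    -- Level k is too crowded for the truncated sum. Pass to a deeper level k₀ with between m/16 and
    -- m/8 expected competitors: if none of them reaches level k, none reaches k₀. That the last
    -- level has expected size at most 1/4 ≤ m/8 is where m ≥ 2 enters.
    obtain ⟨k₀, hk₀L, hk₀, hk₀', hlt⟩ := exists_level_between (p := p) (L := L) hp hL
      (s := ((#S - 1 : ℕ) : ℝ)) (θ := m / 8) (Nat.cast_nonneg _)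
      (hk.trans_le (mul_le_of_le_one_right (Nat.cast_nonneg _) (levelProb_le_one p L k)))
      ((mul_le_mul_of_nonneg_right hsub (levelProb_nonneg p L _)).trans (by linarith))
    have key : ∀ l ∈ S, isolateAtProb p L t S k l ≤ Real.exp (-(m / 16)) + 2 * (1 / 2) ^ m := by
      intro l hl
      have h := abs_rangeProb_sub_bonferroni_le htp hmt (hS l hl) (hS' l)
        (notMem_erase l S) (fun _ => True) (fun y => k₀ ≤ level p L y)
      have h0 := choose_mul_pow_le (levelProb_nonneg p L k₀) hk₀
      have hb := bonferroni_le (m := m) (by omega) (hS' l) (hS l hl) (notMem_erase l S)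
        (fun y => k₀ ≤ level p L y) (by rw [hcard l hl]; exact hk₀)
        (by
          rw [hcard l hl]
          exact le_of_lt (by simpa [div_div, levelProb] using (by linarith [hk₀'] :
            (m : ℝ) / 16 < ((#S - 1 : ℕ) : ℝ) * levelProb p L k₀)))
      rw [rangeProb_of_forall hp fun _ _ => trivial, one_mul, one_mul] at h
      rw [hcard l hl] at h hb
      have hmono : isolateAtProb p L t S k l ≤ rangeProb (p ^ t) (fun y => True ∧
          ∀ i ∈ S.erase l, ¬k₀ ≤ level p L (polyHash p t y i)) :=
        rangeProb_mono fun y _ hy =>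
          ⟨trivial, fun i hi hle => hy.2 i hi ((hlt k hk).le.trans hle)⟩
      have := (abs_le.1 h).2
      rw [levelProb] at h0
      linarith
    have h1 := key i hi
    have h2 := key j hj
    have h3 : 0 ≤ isolateAtProb p L t S k i := rangeProb_nonneg _ _
    have h4 : 0 ≤ isolateAtProb p L t S k j := rangeProb_nonneg _ _
    rw [abs_le]
    constructor <;> linarith

/-- All indices of `S` are isolated with nearly the same probability. -/
theorem abs_isolateProb_sub_le (hL : 0 < L) (htp : t ≤ p) (hmt : m < t) (hm : 2 ≤ m)
    (hS : ∀ i ∈ S, i < p) (hlast : (#S : ℝ) * levelProb p L (L - 1) ≤ 1 / 4) {i j : ℕ}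
    (hi : i ∈ S) (hj : j ∈ S) :
    |isolateProb p L t S i - isolateProb p L t S j| ≤
      L * (Real.exp (-(m / 16)) + 2 * (1 / 2) ^ m) := by
  rw [isolateProb_eq_sum hL, isolateProb_eq_sum hL, ← sum_sub_distrib]
  refine (abs_sum_le_sum_abs _ _).trans ((sum_le_sum fun k _ =>
    abs_isolateAtProb_sub_le hL htp hmt hm hS hlast hi hj k).trans ?_)
  rw [sum_const, card_range, nsmul_eq_mul]

/-- Some index of `S` is isolated with constant probability. -/
theorem one_div_sixteen_le_sum_isolateProb (hL : 0 < L) (htp : t ≤ p) (ht : 2 ≤ t)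
    (hS : ∀ i ∈ S, i < p) (hSne : S.Nonempty)
    (hlast : (#S : ℝ) * levelProb p L (L - 1) ≤ 1 / 4) :
    1 / 16 ≤ ∑ j ∈ S, isolateProb p L t S j := by
  have hp : 0 < p := (Fact.out : p.Prime).pos
  have hS1 : (1 : ℝ) ≤ #S := by exact_mod_cast hSne.card_pos
  obtain ⟨k, hkL, hk, hk', -⟩ := exists_level_between (p := p) (L := L) hp hL
    (s := (#S : ℝ)) (θ := 1 / 4) (Nat.cast_nonneg _) (by linarith) hlast
  -- With τ the probability of level k and s the number of competitors, the first-order inequality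
  -- gives at least τ(1 - 2sτ) ≥ τ/2, because sτ ≤ 1/4. Summing over `S`, whose expected part in
  -- level k exceeds 1/8, yields 1/16.
  have key : ∀ j ∈ S, levelProb p L k / 2 ≤ isolateProb p L t S j := by
    intro j hj
    have h := abs_rangeProb_sub_bonferroni_le (m := 1) htp (by omega) (hS j hj)
      (fun i hi => hS i (mem_of_mem_erase hi)) (notMem_erase j S)
      (fun y => k ≤ level p L y) (fun y => k ≤ level p L y)
    have hmono : rangeProb (p ^ t) (fun y => k ≤ level p L (polyHash p t y j) ∧
          ∀ i ∈ S.erase j, ¬k ≤ level p L (polyHash p t y i)) ≤ isolateProb p L t S j :=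
      rangeProb_mono fun y _ hy i hi => (not_le.1 (hy.2 i hi)).trans_le hy.1
    have hb : bonferroni #(S.erase j) 1 (levelProb p L k) =
        1 - #(S.erase j) * levelProb p L k := by
      simp [bonferroni, sum_range_succ]
      ring
    rw [← levelProb, hb, Nat.choose_one_right, pow_one] at h
    have h1 : (#(S.erase j) : ℝ) * levelProb p L k ≤ 1 / 4 :=
      (mul_le_mul_of_nonneg_right (by exact_mod_cast card_le_card (erase_subset j S))
        (levelProb_nonneg p L k)).trans hk
    have := (abs_le.1 h).1
    nlinarith [levelProb_nonneg p L k]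
  calc (1 : ℝ) / 16 ≤ #S * (levelProb p L k / 2) := by linarith
    _ = ∑ _j ∈ S, levelProb p L k / 2 := by rw [sum_const, nsmul_eq_mul]
    _ ≤ _ := sum_le_sum key

end

end LogSampler

/-! ### Digits -/

section Digits

open Finset

theorem sum_mul_pow_lt {b : ℕ} (d : ℕ → ℕ) {N : ℕ} (hd : ∀ c < N, d c < b) :
    ∑ c ∈ range N, d c * b ^ c < b ^ N := by
  induction N with
  | zero => simp
  | succ N ih =>
    rw [sum_range_succ, pow_succ']
    have h1 := ih fun c hc => hd c (by omega)
    have h2 : (d N + 1) * b ^ N ≤ b * b ^ N := Nat.mul_le_mul_right _ (hd N (by omega))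
    linarith

theorem sum_mul_pow_div_mod {b : ℕ} (d : ℕ → ℕ) {N k : ℕ} (hk : k < N) (hd : ∀ c < N, d c < b) :
    (∑ c ∈ range N, d c * b ^ c) / b ^ k % b = d k := by
  induction N generalizing k d with
  | zero => omega
  | succ N ih =>
    have hb : 0 < b := (Nat.zero_le _).trans_lt (hd 0 (by omega))
    have h : ∑ c ∈ range (N + 1), d c * b ^ c =
        d 0 + b * ∑ c ∈ range N, d (c + 1) * b ^ c := by
      rw [sum_range_succ', mul_sum, pow_zero, mul_one, add_comm]
      congr 1
      exact sum_congr rfl fun c _ => by ring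
    have h0 := hd 0 (by omega)
    rw [h]
    cases k with
    | zero => rw [pow_zero, Nat.div_one, Nat.add_mul_mod_self_left, Nat.mod_eq_of_lt h0]
    | succ k =>
      rw [pow_succ', ← Nat.div_div_eq_div_mul, Nat.add_mul_div_left _ _ hb,
        Nat.div_eq_of_lt h0, zero_add]
      exact ih (fun c => d (c + 1)) (by omega) fun c hc => hd (c + 1) (by omega)

end Digits

/-! ### Frequency vectors indexed by natural numbers -/

namespace TurnstileStream

open Finset

variable {n : ℕ} (σ : TurnstileStream n)

/-- The frequency vector, indexed by all natural numbers. -/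
def natFreq (i : ℕ) : ℤ := ((σ.filter fun u => (u.1 : ℕ) = i).map Prod.snd).sum

theorem freq_eq_natFreq (i : Fin n) : σ.freq i = σ.natFreq i := by
  simp only [freq, natFreq, Fin.ext_iff]

/-- Linearity of the sketch: a functional accumulated update by update depends only on the frequency
vector. -/
theorem sum_natFreq_mul {M : Type*} [CommRing M] (φ : ℕ → M) :
    ∑ i ∈ range n, (σ.natFreq i : M) * φ i = (σ.map fun u => (u.2 : M) * φ u.1).sum := by
  induction σ with
  | nil => simp [natFreq]
  | cons u σ ih =>
    rw [List.map_cons, List.sum_cons, ← ih]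
    have h : ∀ i, (natFreq (u :: σ) i : M) * φ i =
        (if (u.1 : ℕ) = i then (u.2 : M) * φ i else 0) + (natFreq σ i : M) * φ i := by
      intro i
      by_cases hi : (u.1 : ℕ) = i <;> simp [natFreq, hi, add_mul]
    simp only [h]
    rw [sum_add_distrib, sum_ite_eq, if_pos (mem_range.2 u.1.2)]

theorem abs_natFreq_le {m M : ℕ} (h : σ.BoundedBy m M) (i : ℕ) :
    |σ.natFreq i| ≤ ((m * M : ℕ) : ℤ) := by
  obtain ⟨h1, h2⟩ := h
  have h3 : |σ.natFreq i| ≤ ((σ.length * M : ℕ) : ℤ) := by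
    clear h1
    induction σ with
    | nil => simp [natFreq]
    | cons u σ ih =>
      have h4 := ih fun v hv => h2 v (List.mem_cons_of_mem u hv)
      have h5 := h2 u List.mem_cons_self
      have h6 : |natFreq (u :: σ) i| ≤ |u.2| + |natFreq σ i| := by
        by_cases hi : (u.1 : ℕ) = i
        · simpa [natFreq, hi] using abs_add_le u.2 (natFreq σ i)
        · simp [natFreq, hi]
      push_cast [List.length_cons] at h4 ⊢
      linarith
  exact h3.trans (by exact_mod_cast Nat.mul_le_mul_right M h1)

end TurnstileStream

namespace LogSampler

open Finset

/-! ### What the sketch stores -/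

namespace Params

variable (P : Params)

/-- The value of the counter number `c` after the stream `σ`. -/
def counter {n : ℕ} (z : ℕ) (σ : TurnstileStream n) (c : ℕ) : ℕ :=
  (σ.map fun u => (u.2 % (P.p : ℤ)).toNat *
    if P.InLevel (P.repSeed z (c / P.L)) (c % P.L) u.1 then (z % P.p) ^ (u.1 : ℕ) % P.p else 0).sum

variable {P}

theorem seeds_pos (hp : 0 < P.p) : 0 < P.seeds :=
  Nat.mul_pos hp (pow_pos (pow_pos hp _) _)

/-- The seed stays in the low part of the memory. The counters are packed as base-`2 ^ w` digits of
one number, to which each update adds a multiple of a column; reduction modulo `P.sketches` commutes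
with these additions. -/
theorem foldl_update (hp : 0 < P.p) {n : ℕ} {z : ℕ} (hz : z < P.seeds) (σ : TurnstileStream n) :
    σ.foldl (fun s u => P.update s u.1 u.2) z =
      z + P.seeds * ((∑ c ∈ range (P.R * P.L), P.counter z σ c * (2 ^ P.w) ^ c) % P.sketches) := by
  induction σ using List.reverseRecOn with
  | nil => simp [counter]
  | append_singleton σ u ih =>
    rw [List.foldl_append, ih]
    simp only [List.foldl_cons, List.foldl_nil]
    rw [update, if_neg hp.ne', Nat.add_mul_mod_self_left, Nat.mod_eq_of_lt hz,
      Nat.add_mul_div_left _ _ (seeds_pos hp), Nat.div_eq_of_lt hz, zero_add, Nat.mod_add_mod]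
    congr 3
    rw [column, mul_sum, ← sum_add_distrib]
    refine sum_congr rfl fun c _ => ?_
    simp only [counter, List.map_append, List.sum_append, List.map_cons, List.map_nil,
      List.sum_cons, List.sum_nil, pow_mul]
    ring

theorem counter_le (hp : 0 < P.p) {n : ℕ} (z : ℕ) (σ : TurnstileStream n) (c : ℕ) :
    P.counter z σ c ≤ σ.length * (P.p * P.p) := by
  have hp' : (0 : ℤ) < P.p := by exact_mod_cast hp
  have h := List.sum_le_card_nsmul (σ.map fun u => (u.2 % (P.p : ℤ)).toNat *
    if P.InLevel (P.repSeed z (c / P.L)) (c % P.L) u.1 then (z % P.p) ^ (u.1 : ℕ) % P.p else 0)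
    (P.p * P.p) ?_
  · rwa [List.length_map, smul_eq_mul] at h
  · intro x hx
    obtain ⟨u, -, rfl⟩ := List.mem_map.1 hx
    have h1 := Int.emod_lt_of_pos u.2 hp'
    refine Nat.mul_le_mul (by omega) ?_
    split_ifs
    · exact (Nat.mod_lt _ hp).le
    · exact Nat.zero_le _

/-- Modulo p a counter is the value at the base r = z mod p of the polynomial whose coefficients are
the frequencies restricted to one level. -/
theorem counter_cast {n : ℕ} (hp : 0 < P.p) (z : ℕ) (σ : TurnstileStream n) (c : ℕ) :
    (P.counter z σ c : ZMod P.p) = ∑ i ∈ range n, (σ.natFreq i : ZMod P.p) *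
      if P.InLevel (P.repSeed z (c / P.L)) (c % P.L) i then ((z % P.p : ℕ) : ZMod P.p) ^ i
        else 0 := by
  have hp' : (P.p : ℤ) ≠ 0 := by exact_mod_cast hp.ne'
  rw [TurnstileStream.sum_natFreq_mul σ, counter, Nat.cast_list_sum, List.map_map]
  congr 1
  refine List.map_congr_left fun u _ => ?_
  have h1 : (((u.2 % (P.p : ℤ)).toNat : ℕ) : ZMod P.p) = (u.2 : ZMod P.p) := by
    rw [← Int.cast_natCast, Int.toNat_of_nonneg (Int.emod_nonneg _ hp')]
    exact ZMod.intCast_mod _ _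
  rw [Function.comp_apply, Nat.cast_mul, h1]
  split_ifs <;> simp

/-- Counters are sums of nonnegative terms, never reduced modulo p during the stream. The width w is
large enough that no carry occurs, so the digits are the counters themselves. -/
theorem cell_sum_counter (hp : 0 < P.p) {n : ℕ} {z : ℕ} {σ : TurnstileStream n}
    (hw : σ.length * (P.p * P.p) < 2 ^ P.w) {c : ℕ} (hc : c < P.R * P.L) :
    P.cell ((∑ c ∈ range (P.R * P.L), P.counter z σ c * (2 ^ P.w) ^ c) % P.sketches) c =
      P.counter z σ c := by
  have hd : ∀ c < P.R * P.L, P.counter z σ c < 2 ^ P.w :=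
    fun c _ => (counter_le hp z σ c).trans_lt hw
  have hlt := sum_mul_pow_lt (P.counter z σ) hd
  rw [Nat.mod_eq_of_lt (by rw [sketches, pow_mul]; exact hlt), cell, pow_mul,
    sum_mul_pow_div_mod _ hc hd]

end Params

/-! ### Fingerprints -/

/-- Coefficients of absolute value below p that are not all zero remain not all zero modulo p, and a
nonzero polynomial of degree below n has at most n roots. -/
theorem rangeProb_eval_eq_zero_le {p : ℕ} [Fact p.Prime] {n : ℕ} (f : ℕ → ℤ)
    (hf : ∀ i < n, |f i| < p) (hne : ∃ i < n, f i ≠ 0) :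
    rangeProb p (fun r => ∑ i ∈ range n, (f i : ZMod p) * (r : ZMod p) ^ i = 0) ≤ n / p := by
  classical
  rw [rangeProb, rangeMean, sum_propInd]
  refine div_le_div_of_nonneg_right ?_ (Nat.cast_nonneg p)
  let F : Polynomial (ZMod p) :=
    ∑ i ∈ range n, Polynomial.C (f i : ZMod p) * Polynomial.X ^ i
  have hF : F ≠ 0 := by
    obtain ⟨i, hi, hfi⟩ := hne
    intro h
    have h1 : F.coeff i = (f i : ZMod p) := by simp [F, Polynomial.coeff_X_pow, hi]
    rw [h, Polynomial.coeff_zero, eq_comm, ZMod.intCast_zmod_eq_zero_iff_dvd] at h1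
    exact hfi (Int.eq_zero_of_abs_lt_dvd h1 (hf i hi))
  have hdeg : F.degree < n := by
    rw [← Polynomial.mem_degreeLT]
    exact Submodule.sum_mem _ fun e he => Polynomial.mem_degreeLT.2
      ((Polynomial.degree_C_mul_X_pow_le _ _).trans_lt (by exact_mod_cast mem_range.1 he))
  have hnat : F.natDegree ≤ n :=
    ((Polynomial.natDegree_lt_iff_degree_lt hF).2 hdeg).le
  have hcard : #((range p).filter fun r : ℕ => ∑ i ∈ range n, (f i : ZMod p) * (r : ZMod p) ^ i = 0) ≤
      #F.roots.toFinset := by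
    refine card_le_card_of_injOn (fun r : ℕ => (r : ZMod p)) (fun r hr => ?_)
      fun r hr s hs h => ?_
    · rw [mem_coe, Multiset.mem_toFinset, Polynomial.mem_roots hF, Polynomial.IsRoot]
      simpa [F, Polynomial.eval_finsetSum] using (mem_filter.1 hr).2
    · have hr' := mem_range.1 (mem_filter.1 hr).1
      have hs' := mem_range.1 (mem_filter.1 hs).1
      rwa [ZMod.natCast_eq_natCast_iff', Nat.mod_eq_of_lt hr', Nat.mod_eq_of_lt hs'] at h
  exact_mod_cast hcard.trans ((Multiset.toFinset_card_le _).trans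
    ((Polynomial.card_roots' F).trans hnat))

theorem rangeProb_exists_le {ι : Type*} (N : ℕ) (A : Finset ι) (E : ι → ℕ → Prop) :
    rangeProb N (fun x => ∃ a ∈ A, E a x) ≤ ∑ a ∈ A, rangeProb N (E a) := by
  simp only [rangeProb]
  rw [← rangeMean_sum]
  refine rangeMean_mono fun x _ => ?_
  by_cases h : ∃ a ∈ A, E a x
  · obtain ⟨a, ha, hE⟩ := h
    rw [propInd_true ⟨a, ha, hE⟩, ← propInd_true hE]
    exact single_le_sum (f := fun a => propInd (E a x)) (fun _ _ => propInd_nonneg _) ha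
  · rw [propInd_false h]
    exact sum_nonneg fun _ _ => propInd_nonneg _

/-! ### Ideal repetitions, and their agreement with the sketch for a good base. -/

section Ideal

variable (P : Params) {n : ℕ} (σ : TurnstileStream n)

/-- The indices of nonzero frequency. -/
def support : Finset ℕ := {i ∈ range n | σ.natFreq i ≠ 0}

/-- The event, for the seed `y` of one repetition, that this repetition should find `j`. -/
def IdealFinds (y j : ℕ) : Prop :=
  j ∈ support σ ∧ Isolates P.p P.L P.t (support σ) (y / P.p) j ∧
    P.Accepts (y % P.p) (σ.natFreq j).natAbs

open Classical in
/-- One more than the index that the repetition with seed `y` should find, or zero. -/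
noncomputable def idealOut (y : ℕ) : ℕ :=
  ∑ j ∈ range n, if IdealFinds P σ y j then j + 1 else 0

/-- The value `r` is a bad base of the fingerprints: some counter looks like that of
a vector that it does not belong to. -/
def BadBase (y r : ℕ) : Prop :=
  ∃ a ∈ range (P.R * P.L) ×ˢ Icc (-(P.V : ℤ)) P.V ×ˢ range n,
    (∃ i < n, (if P.InLevel (y / P.repSeeds ^ (a.1 / P.L) % P.repSeeds) (a.1 % P.L) i
      then σ.natFreq i else 0) - (if i = a.2.2 then a.2.1 else 0) ≠ 0) ∧
    ∑ i ∈ range n, (((if P.InLevel (y / P.repSeeds ^ (a.1 / P.L) % P.repSeeds) (a.1 % P.L) i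
      then σ.natFreq i else 0) - (if i = a.2.2 then a.2.1 else 0) : ℤ) : ZMod P.p) *
        (r : ZMod P.p) ^ i = 0

variable {P σ}

theorem IdealFinds.unique {y i j : ℕ} (hi : IdealFinds P σ y i) (hj : IdealFinds P σ y j) :
    i = j := by
  by_contra h
  have h1 := hi.2.1 j (mem_erase.2 ⟨Ne.symm h, hj.1⟩)
  have h2 := hj.2.1 i (mem_erase.2 ⟨h, hi.1⟩)
  omega

/-- At most one index is isolated, so the defining sum has at most one nonzero term; the shift by 1
keeps index 0 apart from failure. -/
theorem idealOut_eq_iff {y j : ℕ} : idealOut P σ y = j + 1 ↔ IdealFinds P σ y j := by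
  have key : ∀ i, IdealFinds P σ y i → idealOut P σ y = i + 1 := by
    intro i hi
    have hin : i ∈ range n := (mem_filter.1 hi.1).1
    rw [idealOut, sum_eq_single_of_mem i hin fun l _ hl => if_neg fun h => hl (h.unique hi),
      if_pos hi]
  refine ⟨fun h => ?_, key j⟩
  by_cases hex : ∃ i, IdealFinds P σ y i
  · obtain ⟨i, hi⟩ := hex
    have := key i hi
    have : i = j := by omega
    exact this ▸ hi
  · push Not at hex
    rw [idealOut, sum_eq_zero fun i _ => if_neg (hex i)] at h
    omega

/-- Union bound over R L counters, 2V + 1 values and n positions. The compared vectors differ by at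
most 2V < p in each entry, so each pair of distinct ones collides with probability at most n/p. -/
theorem rangeProb_badBase_le [Fact P.p.Prime] (hV : 2 * P.V < P.p)
    (hσ : ∀ i, |σ.natFreq i| ≤ (P.V : ℤ)) (y : ℕ) :
    rangeProb P.p (BadBase P σ y) ≤ P.R * P.L * ((2 * P.V + 1) * n) * (n / P.p) := by
  refine (rangeProb_exists_le _ _ _).trans ?_
  have hcard : ((#(range (P.R * P.L) ×ˢ Icc (-(P.V : ℤ)) P.V ×ˢ range n) : ℕ) : ℝ) =
      P.R * P.L * ((2 * P.V + 1) * n) := by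
    rw [card_product, card_product, card_range, card_range, Int.card_Icc,
      show ((P.V : ℤ) + 1 - -(P.V : ℤ)).toNat = 2 * P.V + 1 by omega]
    push_cast
    ring
  rw [← hcard, ← nsmul_eq_mul]
  refine sum_le_card_nsmul _ _ _ fun a ha => ?_
  obtain ⟨-, ha2⟩ := mem_product.1 ha
  have hv := mem_Icc.1 (mem_product.1 ha2).1
  by_cases hne : ∃ i < n, (if P.InLevel (y / P.repSeeds ^ (a.1 / P.L) % P.repSeeds) (a.1 % P.L) i
      then σ.natFreq i else 0) - (if i = a.2.2 then a.2.1 else 0) ≠ 0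
  · refine (rangeProb_mono fun r _ h => h.2).trans (rangeProb_eval_eq_zero_le _ (fun i _ => ?_) hne)
    have h1 := abs_le.1 (hσ i)
    rw [abs_lt]
    split_ifs <;> constructor <;> omega
  · refine le_trans (le_of_eq ?_) (by positivity : (0 : ℝ) ≤ n / P.p)
    exact rangeProb_eq_zero fun r _ h => hne h.1

/-- For a good base, a repetition finds what it should find. -/
theorem finds_iff [Fact P.p.Prime] (hL : 0 < P.L) (hσ : ∀ i, |σ.natFreq i| ≤ (P.V : ℤ))
    (hw : σ.length * (P.p * P.p) < 2 ^ P.w) {y r : ℕ} (hr : r < P.p) (hgood : ¬BadBase P σ y r)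
    {ρ j : ℕ} (hρ : ρ < P.R) (hj : j < n) :
    P.Finds (r + P.p * y) ((∑ c ∈ range (P.R * P.L),
        P.counter (r + P.p * y) σ c * (2 ^ P.w) ^ c) % P.sketches) ρ j ↔
      IdealFinds P σ (y / P.repSeeds ^ ρ % P.repSeeds) j := by
  have hp : 0 < P.p := (Fact.out : P.p.Prime).pos
  have hzr : (r + P.p * y) % P.p = r := by rw [Nat.add_mul_mod_self_left, Nat.mod_eq_of_lt hr]
  have hzy : (r + P.p * y) / P.p = y := by
    rw [Nat.add_mul_div_left _ _ hp, Nat.div_eq_of_lt hr, zero_add]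
  have hrep : ∀ ρ, P.repSeed (r + P.p * y) ρ = y / P.repSeeds ^ ρ % P.repSeeds := by
    intro ρ
    rw [Params.repSeed, hzy]
  set η := y / P.repSeeds ^ ρ % P.repSeeds with hη
  have hc : ∀ k < P.L, ρ * P.L + k < P.R * P.L := by
    intro k hk
    calc ρ * P.L + k < (ρ + 1) * P.L := by linarith
      _ ≤ P.R * P.L := Nat.mul_le_mul_right _ hρ
  have hdiv : ∀ k < P.L, (ρ * P.L + k) / P.L = ρ := fun k hk => by
    rw [mul_comm, Nat.mul_add_div hL, Nat.div_eq_of_lt hk, add_zero]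
  have hmod : ∀ k < P.L, (ρ * P.L + k) % P.L = k := fun k hk => by
    rw [mul_comm, Nat.mul_add_mod, Nat.mod_eq_of_lt hk]
  have hcount : ∀ k < P.L, (P.counter (r + P.p * y) σ (ρ * P.L + k) : ZMod P.p) =
      ∑ i ∈ range n, ((if P.InLevel η k i then σ.natFreq i else 0 : ℤ) : ZMod P.p) *
        (r : ZMod P.p) ^ i := by
    intro k hk
    rw [Params.counter_cast hp, hdiv k hk, hmod k hk, hzr, hrep]
    refine sum_congr rfl fun i _ => ?_
    split_ifs <;> simp
  have hsum : ∀ k < P.L, ∀ v : ℤ,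
      ∑ i ∈ range n, (((if P.InLevel η k i then σ.natFreq i else 0) -
        (if i = j then v else 0) : ℤ) : ZMod P.p) * (r : ZMod P.p) ^ i =
      (P.counter (r + P.p * y) σ (ρ * P.L + k) : ZMod P.p) - v * (r : ZMod P.p) ^ j := by
    intro k hk v
    rw [hcount k hk]
    simp only [Int.cast_sub, sub_mul]
    rw [sum_sub_distrib]
    congr 1
    rw [sum_eq_single_of_mem j (mem_range.2 hj) fun i _ hi => by simp [hi]]
    simp
  -- a matching fingerprint identifies the restricted vector
  have hident : ∀ k < P.L, ∀ v : ℤ, |v| ≤ P.V →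
      (P.counter (r + P.p * y) σ (ρ * P.L + k) : ZMod P.p) = v * (r : ZMod P.p) ^ j →
      ∀ i < n, (if P.InLevel η k i then σ.natFreq i else 0) = if i = j then v else 0 := by
    intro k hk v hv heq i hi
    by_contra hne
    refine hgood ⟨(ρ * P.L + k, v, j), ?_, ⟨i, hi, ?_⟩, ?_⟩
    · simp only [mem_product, mem_range, mem_Icc]
      exact ⟨hc k hk, abs_le.1 hv, hj⟩
    · simp only [hdiv k hk, hmod k hk]
      exact sub_ne_zero.2 hne
    · simp only [hdiv k hk, hmod k hk]
      rw [← hη, hsum k hk, heq, sub_self]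
  -- If level k retains just the index j of the support, then j reaches level k while all other
  -- support elements stop earlier.
  have hmain : ∀ k < P.L, ∀ v : ℤ, v ≠ 0 →
      (∀ i < n, (if P.InLevel η k i then σ.natFreq i else 0) = if i = j then v else 0) →
      j ∈ support σ ∧ σ.natFreq j = v ∧ Isolates P.p P.L P.t (support σ) (η / P.p) j := by
    intro k hk v hv h
    have hjv := h j hj
    rw [if_pos rfl] at hjv
    have hjl : P.InLevel η k j := by
      by_contra hn
      rw [if_neg hn] at hjv
      exact hv hjv.symm
    rw [if_pos hjl] at hjv
    refine ⟨mem_filter.2 ⟨mem_range.2 hj, hjv ▸ hv⟩, hjv, fun i hi => ?_⟩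
    obtain ⟨hij, hi⟩ := mem_erase.1 hi
    obtain ⟨hin, hi0⟩ := mem_filter.1 hi
    have hi' := h i (mem_range.1 hin)
    rw [if_neg hij] at hi'
    have hil : ¬P.InLevel η k i := fun hn => hi0 (by rwa [if_pos hn] at hi')
    have h1 : ¬k ≤ level P.p P.L (polyHash P.p P.t (η / P.p) i) := fun hn =>
      hil ((le_level_iff hk (polyHash_lt hp _ _ _)).1 hn)
    exact (not_le.1 h1).trans_le ((le_level_iff hk (polyHash_lt hp _ _ _)).2 hjl)
  have hcong1 : ∀ a v : ℕ, a % P.p = v * r ^ j % P.p ↔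
      (a : ZMod P.p) = ((v : ℤ) : ZMod P.p) * (r : ZMod P.p) ^ j := by
    intro a v
    rw [← ZMod.natCast_eq_natCast_iff']
    push_cast
    rfl
  -- The second alternative in `Finds` covers a negative entry -v, stated additively to stay within
  -- the natural numbers.
  have hcong2 : ∀ a v : ℕ, (a + v * r ^ j) % P.p = 0 ↔
      (a : ZMod P.p) = ((-v : ℤ) : ZMod P.p) * (r : ZMod P.p) ^ j := by
    intro a v
    rw [← Nat.dvd_iff_mod_eq_zero, ← ZMod.natCast_eq_zero_iff]
    push_cast
    rw [neg_mul, eq_neg_iff_add_eq_zero]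
  simp only [Params.Finds, IdealFinds, hzr, hrep]
  rw [← hη]
  constructor
  · rintro ⟨k, hk, v, hv, ⟨hv0, hacc⟩, h⟩
    rw [Params.cell_sum_counter hp hw (hc k hk), hcong1, hcong2] at h
    have hvV : |(v : ℤ)| ≤ P.V := by rw [abs_le]; constructor <;> omega
    rcases h with h | h
    · obtain ⟨h1, h2, h3⟩ := hmain k hk v (by omega) (hident k hk v hvV h)
      exact ⟨h1, h3, by rw [h2]; simpa using hacc⟩
    · obtain ⟨h1, h2, h3⟩ := hmain k hk (-v) (by omega)
        (hident k hk (-v) (by rwa [abs_neg]) h)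
      exact ⟨h1, h3, by rw [h2]; simpa using hacc⟩
  · rintro ⟨hjS, hiso, hacc⟩
    have hj0 : σ.natFreq j ≠ 0 := (mem_filter.1 hjS).2
    have hkL := level_lt (p := P.p) hL (polyHash P.p P.t (η / P.p) j)
    set k := level P.p P.L (polyHash P.p P.t (η / P.p) j) with hk
    have hjV := abs_le.1 (hσ j)
    -- The witness is the deepest level of j itself, which no other support element reaches.
    refine ⟨k, hkL, (σ.natFreq j).natAbs, by omega, ⟨by omega, hacc⟩, ?_⟩
    rw [Params.cell_sum_counter hp hw (hc k hkL), hcong1, hcong2]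
    have heq : (P.counter (r + P.p * y) σ (ρ * P.L + k) : ZMod P.p) =
        (σ.natFreq j : ZMod P.p) * (r : ZMod P.p) ^ j := by
      rw [hcount k hkL, sum_eq_single_of_mem j (mem_range.2 hj)]
      · have hjl : P.InLevel η k j := (le_level_iff hkL (polyHash_lt hp _ _ _)).1 hk.le
        rw [if_pos hjl]
      · intro i hi hij
        by_cases hi0 : σ.natFreq i = 0
        · simp [hi0]
        · have h1 := hiso i (mem_erase.2 ⟨hij, mem_filter.2 ⟨hi, hi0⟩⟩)
          have h2 : ¬P.InLevel η k i := fun hn =>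
            absurd ((le_level_iff hkL (polyHash_lt hp _ _ _)).2 hn) (not_le.2 h1)
          simp [h2]
    rcases Int.natAbs_eq (σ.natFreq j) with h | h
    · left; rw [← h]; exact heq
    · right; rw [← h]; exact heq

theorem lastNonzero_congr {f g : ℕ → ℕ} {R : ℕ} (h : ∀ ρ < R, f ρ = g ρ) :
    lastNonzero f R = lastNonzero g R := by
  induction R with
  | zero => rfl
  | succ R ih => rw [lastNonzero, lastNonzero, h R (by omega), ih fun ρ hρ => h ρ (by omega)]

/-- The final memory on the stream `σ` for the initial seed `z`, reduced to seed and sketch, gives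
nearly the law of the last success among independent ideal repetitions. -/
theorem abs_rangeProb_answer_sub_le [Fact P.p.Prime] (hL : 0 < P.L) (hV : 2 * P.V < P.p)
    (hσ : ∀ i, |σ.natFreq i| ≤ (P.V : ℤ)) (hw : σ.length * (P.p * P.p) < 2 ^ P.w)
    (T : ℕ → Prop) :
    |rangeProb P.seeds (fun z => T (lastNonzero (P.repOut n z ((∑ c ∈ range (P.R * P.L),
        P.counter z σ c * (2 ^ P.w) ^ c) % P.sketches)) P.R)) -
      rangeProb (P.repSeeds ^ P.R) (fun y => T (lastNonzero
        (fun ρ => idealOut P σ (y / P.repSeeds ^ ρ % P.repSeeds)) P.R))| ≤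
      P.R * P.L * ((2 * P.V + 1) * n) * (n / P.p) := by
  classical
  have hp : 0 < P.p := (Fact.out : P.p.Prime).pos
  have hQ : 0 < P.repSeeds ^ P.R := pow_pos (pow_pos hp _) _
  -- The seed splits as r + p y. The ideal outcome depends on y alone, and for fixed y the two
  -- outcomes differ only if r is a bad base.
  rw [rangeProb, Params.seeds, rangeMean_mul, rangeProb, ← rangeMean_sub]
  refine (abs_rangeMean_le _ _).trans ?_
  refine le_trans (rangeMean_mono (g := fun _ => (P.R * P.L * ((2 * P.V + 1) * n) * (n / P.p) : ℝ))
    fun y _ => ?_) (rangeMean_const hQ _).le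
  rw [← rangeMean_const hp (propInd (T (lastNonzero
    (fun ρ => idealOut P σ (y / P.repSeeds ^ ρ % P.repSeeds)) P.R))), ← rangeMean_sub]
  refine (abs_rangeMean_le _ _).trans (le_trans (rangeMean_mono fun r hr => ?_)
    (rangeProb_badBase_le hV hσ y))
  by_cases hbad : BadBase P σ y r
  · rw [propInd_true hbad, abs_le]
    have h1 := propInd_nonneg (T (lastNonzero (P.repOut n (r + P.p * y)
      ((∑ c ∈ range (P.R * P.L), P.counter (r + P.p * y) σ c * (2 ^ P.w) ^ c) % P.sketches)) P.R))
    have h2 := propInd_le_one (T (lastNonzero (P.repOut n (r + P.p * y)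
      ((∑ c ∈ range (P.R * P.L), P.counter (r + P.p * y) σ c * (2 ^ P.w) ^ c) % P.sketches)) P.R))
    have h3 := propInd_nonneg (T (lastNonzero
      (fun ρ => idealOut P σ (y / P.repSeeds ^ ρ % P.repSeeds)) P.R))
    have h4 := propInd_le_one (T (lastNonzero
      (fun ρ => idealOut P σ (y / P.repSeeds ^ ρ % P.repSeeds)) P.R))
    constructor <;> linarith
  · rw [propInd_false hbad]
    have : lastNonzero (P.repOut n (r + P.p * y) ((∑ c ∈ range (P.R * P.L),
        P.counter (r + P.p * y) σ c * (2 ^ P.w) ^ c) % P.sketches)) P.R =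
        lastNonzero (fun ρ => idealOut P σ (y / P.repSeeds ^ ρ % P.repSeeds)) P.R := by
      refine lastNonzero_congr fun ρ hρ => ?_
      rw [Params.repOut, idealOut]
      refine sum_congr rfl fun j hj => ?_
      simp only [finds_iff hL hσ hw hr hbad hρ (mem_range.1 hj)]
    rw [this, sub_self, abs_zero]

end Ideal

end LogSampler

namespace LogSampler

open Finset

/-! ### Independent repetitions -/

/-- The last nonzero value of `g` at the lowest `R` base-`Q` digits of `y`. -/
def lastDigitOut (Q : ℕ) (g : ℕ → ℕ) (R y : ℕ) : ℕ :=
  lastNonzero (fun ρ => g (y / Q ^ ρ % Q)) R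

/-- The top digit decides unless its trial fails; the lower digits are independent of it, which
gives a recursion in `R`. -/
theorem lastDigitOut_succ {Q : ℕ} (g : ℕ → ℕ) {R x y : ℕ} (hx : x < Q ^ R) (hy : y < Q) :
    lastDigitOut Q g (R + 1) (x + Q ^ R * y) =
      if g y = 0 then lastDigitOut Q g R x else g y := by
  have hQ : 0 < Q := by omega
  have h1 : (x + Q ^ R * y) / Q ^ R % Q = y := by
    rw [Nat.add_mul_div_left _ _ (pow_pos hQ R), Nat.div_eq_of_lt hx, zero_add, Nat.mod_eq_of_lt hy]
  rw [lastDigitOut, lastNonzero, h1]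
  refine if_congr Iff.rfl (lastNonzero_congr fun ρ hρ => ?_) rfl
  obtain ⟨d, rfl⟩ := Nat.exists_eq_add_of_lt hρ
  have h2 : x + Q ^ (ρ + d + 1) * y = x + Q ^ ρ * (Q * (Q ^ d * y)) := by ring
  rw [h2, Nat.add_mul_div_left _ _ (pow_pos hQ ρ), Nat.add_mul_mod_self_left]

theorem rangeProb_lastDigitOut_succ {Q : ℕ} (hQ : 0 < Q) (g : ℕ → ℕ) (R v : ℕ) :
    rangeProb (Q ^ (R + 1)) (fun y => lastDigitOut Q g (R + 1) y = v) =
      (1 - rangeProb Q fun y => g y ≠ 0) *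
        rangeProb (Q ^ R) (fun y => lastDigitOut Q g R y = v) +
      rangeProb Q fun y => g y ≠ 0 ∧ g y = v := by
  set B := rangeProb (Q ^ R) (fun y => lastDigitOut Q g R y = v)
  rw [rangeProb, pow_succ, rangeMean_mul]
  have h : ∀ y < Q, (rangeMean (Q ^ R) fun x =>
      propInd (lastDigitOut Q g (R + 1) (x + Q ^ R * y) = v)) =
      (1 - propInd (g y ≠ 0)) * B + propInd (g y ≠ 0 ∧ g y = v) := by
    intro y hy
    rw [rangeMean_congr fun x hx => by rw [lastDigitOut_succ g hx hy]]
    by_cases h0 : g y = 0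
    · simp only [h0, if_true, ne_eq, not_true_eq_false, false_and]
      rw [propInd_false not_false]
      simp [B, rangeProb]
    · simp only [h0, if_false, ne_eq, not_false_eq_true, true_and]
      rw [rangeMean_const (pow_pos hQ R), propInd_true trivial]
      ring
  rw [rangeMean_congr h, rangeMean_add, rangeMean_mul_const, rangeMean_sub, rangeMean_const hQ]
  rfl

theorem rangeProb_lastDigitOut_eq_zero {Q : ℕ} (hQ : 0 < Q) (g : ℕ → ℕ) (R : ℕ) :
    rangeProb (Q ^ R) (fun y => lastDigitOut Q g R y = 0) =
      (1 - rangeProb Q fun y => g y ≠ 0) ^ R := by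
  induction R with
  | zero => exact rangeProb_of_forall (by simp) fun _ _ => rfl
  | succ R ih =>
    have h : rangeProb Q (fun y => g y ≠ 0 ∧ g y = 0) = 0 :=
      rangeProb_eq_zero fun y _ h => h.1 h.2
    rw [rangeProb_lastDigitOut_succ hQ, ih, h, pow_succ]
    ring

/-- A geometric series: with A the success probability of one trial, the last success equals v with
probability P(g = v) times the sum of (1 - A)^i over i < R. So conditioning on success reproduces
the conditional law of one trial without error. -/
theorem mul_rangeProb_lastDigitOut {Q : ℕ} (hQ : 0 < Q) (g : ℕ → ℕ) (R : ℕ) {v : ℕ}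
    (hv : v ≠ 0) :
    (rangeProb Q fun y => g y ≠ 0) * rangeProb (Q ^ R) (fun y => lastDigitOut Q g R y = v) =
      (rangeProb Q fun y => g y = v) * (1 - (1 - rangeProb Q fun y => g y ≠ 0) ^ R) := by
  have h : rangeProb Q (fun y => g y ≠ 0 ∧ g y = v) = rangeProb Q fun y => g y = v :=
    rangeProb_congr fun y _ => ⟨fun h => h.2, fun h => ⟨h ▸ hv, h⟩⟩
  induction R with
  | zero =>
    have : rangeProb (Q ^ 0) (fun y => lastDigitOut Q g 0 y = v) = 0 :=
      rangeProb_eq_zero fun y _ h => hv h.symm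
    rw [this]
    simp
  | succ R ih =>
    rw [rangeProb_lastDigitOut_succ hQ, h, mul_add, mul_left_comm, ih, pow_succ]
    ring

/-! ### The law of one ideal repetition -/

/-- The probability that the rejection step keeps the absolute value `v`. -/
noncomputable def acceptProb (P : Params) (v : ℕ) : ℝ := rangeProb P.p fun u => P.Accepts u v

/-- With θ = log(1+v)/log(1+V), taking logarithms turns acceptance into u < pθ, so exactly ⌈pθ⌉ of
the p coins accept. -/
theorem acceptProb_bounds {P : Params} (hp : 0 < P.p) {v : ℕ} (hv : v ≤ P.V) (hV : 0 < P.V) :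
    Real.log (1 + v) / Real.log (1 + P.V) ≤ acceptProb P v ∧
      acceptProb P v ≤ Real.log (1 + v) / Real.log (1 + P.V) + 1 / P.p := by
  have hp' : (0 : ℝ) < P.p := by exact_mod_cast hp
  have hV' : (0 : ℝ) < P.V := by exact_mod_cast hV
  have hv' : (v : ℝ) ≤ P.V := by exact_mod_cast hv
  have hv0 : (0 : ℝ) ≤ v := Nat.cast_nonneg v
  have hlog : 0 < Real.log (1 + P.V) := Real.log_pos (by linarith)
  set θ := Real.log (1 + v) / Real.log (1 + P.V) with hθ
  have hθ0 : 0 ≤ θ := div_nonneg (Real.log_nonneg (by linarith)) hlog.le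
  have hθ1 : θ ≤ 1 :=
    (div_le_one hlog).2 (Real.log_le_log (by linarith) (by linarith))
  have hacc : ∀ u : ℕ, P.Accepts u v ↔ (u : ℝ) < P.p * θ := by
    intro u
    have h1 : P.Accepts u v ↔ (1 + P.V : ℝ) ^ u < (1 + v : ℝ) ^ P.p := by
      unfold Params.Accepts
      exact_mod_cast Iff.rfl
    rw [h1, ← Real.log_lt_log_iff (by positivity) (by positivity), Real.log_pow, Real.log_pow, hθ,
      ← mul_div_assoc, lt_div_iff₀ hlog]
  have hceil : ⌈P.p * θ⌉₊ ≤ P.p := Nat.ceil_le.2 (mul_le_of_le_one_right hp'.le hθ1)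
  have hcard : acceptProb P v = (⌈P.p * θ⌉₊ : ℝ) / P.p := by
    rw [acceptProb, rangeProb, rangeMean, sum_propInd]
    congr 2
    rw [← card_range ⌈P.p * θ⌉₊]
    congr 1
    ext u
    rw [mem_filter, mem_range, mem_range, hacc, Nat.lt_ceil]
    refine ⟨fun h => h.2, fun h => ⟨?_, h⟩⟩
    exact (Nat.lt_ceil.2 h).trans_le hceil
  have h1 := Nat.le_ceil ((P.p : ℝ) * θ)
  have h2 := Nat.ceil_lt_add_one (mul_nonneg hp'.le hθ0)
  rw [hcard]
  constructor
  · rw [le_div_iff₀ hp']; linarith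
  · rw [div_le_iff₀ hp', add_mul, one_div_mul_cancel hp'.ne']; linarith

section

variable (P : Params) {n : ℕ} (σ : TurnstileStream n)

/-- The rejection coin is the lowest base-`p` digit of the seed and the hash coefficients are the
others, so isolation and acceptance are independent. -/
theorem rangeProb_idealFinds (hp : 0 < P.p) {j : ℕ} (hj : j ∈ support σ) :
    rangeProb P.repSeeds (fun y => IdealFinds P σ y j) =
      isolateProb P.p P.L P.t (support σ) j * acceptProb P (σ.natFreq j).natAbs := by
  rw [rangeProb, Params.repSeeds, pow_succ', rangeMean_mul]
  have h : ∀ c, (rangeMean P.p fun u => propInd (IdealFinds P σ (u + P.p * c) j)) =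
      propInd (Isolates P.p P.L P.t (support σ) c j) * acceptProb P (σ.natFreq j).natAbs := by
    intro c
    rw [acceptProb, rangeProb, ← rangeMean_const_mul]
    refine rangeMean_congr fun u hu => ?_
    rw [← propInd_and]
    congr 1
    rw [IdealFinds, Nat.add_mul_div_left _ _ hp, Nat.div_eq_of_lt hu, zero_add,
      Nat.add_mul_mod_self_left, Nat.mod_eq_of_lt hu, eq_iff_iff]
    exact ⟨fun h => h.2, fun h => ⟨hj, h⟩⟩
  simp only [h]
  rw [rangeMean_mul_const]
  rfl

theorem rangeProb_idealOut_ne_zero :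
    rangeProb P.repSeeds (fun y => idealOut P σ y ≠ 0) =
      ∑ j ∈ support σ, rangeProb P.repSeeds fun y => IdealFinds P σ y j := by
  simp only [rangeProb]
  rw [← rangeMean_sum]
  refine rangeMean_congr fun y _ => ?_
  by_cases h : ∃ j, IdealFinds P σ y j
  · obtain ⟨j, hj⟩ := h
    rw [sum_eq_single_of_mem j hj.1 fun i _ hij => propInd_false fun hi => hij (hi.unique hj),
      propInd_true hj, propInd_true]
    rw [idealOut_eq_iff.2 hj]
    omega
  · push Not at h
    rw [sum_eq_zero fun j _ => propInd_false (h j), propInd_false]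
    intro h0
    obtain ⟨j, hj⟩ := Nat.exists_eq_succ_of_ne_zero h0
    exact h j (idealOut_eq_iff.1 hj)

end

/-! ### Estimates for normalized weights -/

/-- For fixed j all scaled weights Λ q_i α_i lie within Λ(ε + δ) of q_j G_i, and the common factor
q_j cancels on normalization. It thus suffices that the q_i are nearly equal and their sum is not
small; no lower bound on a single q_i is needed. -/
theorem abs_div_sum_sub_div_sum_le {S : Finset ℕ} {q α G : ℕ → ℝ} {Λ ε δ : ℝ} (hΛ : 0 < Λ)
    (hε : 0 ≤ ε) (hδ : 0 ≤ δ) (hq0 : ∀ i ∈ S, 0 ≤ q i) (hq1 : ∀ i ∈ S, q i ≤ 1)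
    (hq : ∀ i ∈ S, ∀ j ∈ S, |q i - q j| ≤ ε) (hsum : 1 / 16 ≤ ∑ i ∈ S, q i)
    (hG : ∀ i ∈ S, Real.log 2 ≤ G i) (hGΛ : ∀ i ∈ S, G i ≤ Λ)
    (hα : ∀ i ∈ S, G i / Λ ≤ α i ∧ α i ≤ G i / Λ + δ) :
    Real.log 2 / (16 * Λ) ≤ ∑ i ∈ S, q i * α i ∧ ∀ j ∈ S,
      |q j * α j / ∑ i ∈ S, q i * α i - G j / ∑ i ∈ S, G i| ≤ 64 * #S * (Λ * (ε + δ)) := by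
  have hl2 := Real.log_two_gt_d9
  have hA : Real.log 2 / (16 * Λ) ≤ ∑ i ∈ S, q i * α i := by
    calc Real.log 2 / (16 * Λ) = 1 / 16 * (Real.log 2 / Λ) := by field_simp
      _ ≤ (∑ i ∈ S, q i) * (Real.log 2 / Λ) := by gcongr
      _ = ∑ i ∈ S, q i * (Real.log 2 / Λ) := sum_mul _ _ _
      _ ≤ ∑ i ∈ S, q i * α i := sum_le_sum fun i hi => mul_le_mul_of_nonneg_left
          ((div_le_div_of_nonneg_right (hG i hi) hΛ.le).trans (hα i hi).1) (hq0 i hi)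
  refine ⟨hA, fun j hj => ?_⟩
  set A := ∑ i ∈ S, q i * α i
  set T := ∑ i ∈ S, G i
  set η := Λ * (ε + δ)
  have hη : 0 ≤ η := by positivity
  have hApos : 0 < A := lt_of_lt_of_le (by positivity) hA
  -- From log 2 / 16 ≥ 1/32; dividing the later bound with factor 2 by this gives the constant 64.
  have hW : 1 / 32 ≤ Λ * A := by
    have := mul_le_mul_of_nonneg_left hA hΛ.le
    have h2 : Λ * (Real.log 2 / (16 * Λ)) = Real.log 2 / 16 := by field_simp
    linarith
  have hGpos : ∀ i ∈ S, 0 < G i := fun i hi => by linarith [hG i hi]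
  have hT : 0 < T := sum_pos hGpos ⟨j, hj⟩
  have hGT : G j ≤ T := single_le_sum (f := G) (fun i hi => (hGpos i hi).le) hj
  have hcard : (1 : ℝ) ≤ #S := by exact_mod_cast card_pos.2 ⟨j, hj⟩
  have hw : ∀ i ∈ S, |Λ * (q i * α i) - q j * G i| ≤ η := by
    intro i hi
    obtain ⟨h1, h2⟩ := hα i hi
    have h3 : Λ * (q i * α i) - q j * G i =
        (q i - q j) * G i + q i * (Λ * (α i - G i / Λ)) := by field_simp; ring
    have h4 : |(q i - q j) * G i| ≤ ε * Λ := by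
      rw [abs_mul, abs_of_pos (hGpos i hi)]
      exact mul_le_mul (hq i hi j hj) (hGΛ i hi) (hGpos i hi).le hε
    have h5 : |q i * (Λ * (α i - G i / Λ))| ≤ 1 * (Λ * δ) := by
      have : 0 ≤ α i - G i / Λ := sub_nonneg.2 h1
      rw [abs_of_nonneg (mul_nonneg (hq0 i hi) (mul_nonneg hΛ.le this))]
      exact mul_le_mul (hq1 i hi) (mul_le_mul_of_nonneg_left (by linarith) hΛ.le)
        (by positivity) zero_le_one
    rw [h3]
    refine (abs_add_le _ _).trans ?_
    simp only [η]
    linarith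
  have hWT : |Λ * A - q j * T| ≤ #S * η := by
    simp only [A, T]
    rw [mul_sum, mul_sum, ← sum_sub_distrib]
    refine (abs_sum_le_sum_abs _ _).trans ((sum_le_sum hw).trans ?_)
    rw [sum_const, nsmul_eq_mul]
  have hnum : |Λ * (q j * α j) * T - G j * (Λ * A)| ≤ 2 * #S * η * T := by
    have h6 : Λ * (q j * α j) * T - G j * (Λ * A) =
        (Λ * (q j * α j) - q j * G j) * T - G j * (Λ * A - q j * T) := by ring
    rw [h6]
    refine (abs_sub _ _).trans ?_
    rw [abs_mul, abs_mul, abs_of_pos hT, abs_of_pos (hGpos j hj)]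
    have h7 : |Λ * (q j * α j) - q j * G j| * T ≤ #S * η * T :=
      mul_le_mul_of_nonneg_right ((hw j hj).trans (le_mul_of_one_le_left hη hcard)) hT.le
    have h8 : G j * |Λ * A - q j * T| ≤ T * (#S * η) :=
      mul_le_mul hGT hWT (abs_nonneg _) hT.le
    linarith
  have hfrac : q j * α j / A - G j / T =
      (Λ * (q j * α j) * T - G j * (Λ * A)) / (Λ * A * T) := by
    field_simp
  rw [hfrac, abs_div, abs_of_pos (by positivity : 0 < Λ * A * T), div_le_iff₀ (by positivity)]
  refine hnum.trans ?_
  have h9 : 2 * (#S : ℝ) * η * T ≤ 64 * #S * η * T * (Λ * A) := by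
    have : 0 ≤ (#S : ℝ) * η * T := by positivity
    nlinarith
  linarith

/-- Transfers a conditional probability r = x₀/s₀ to nearby x and s: the numerator errs by at most
2δ, and 2δ/0.99 ≤ 3δ. -/
theorem abs_div_sub_le {x s x₀ s₀ r δ : ℝ} (hx : |x - x₀| ≤ δ) (hs : |s - s₀| ≤ δ)
    (hr0 : 0 ≤ r) (hr1 : r ≤ 1) (hx₀ : x₀ = r * s₀) (hs1 : 0.99 ≤ s) : |x / s - r| ≤ 3 * δ := by
  have hspos : 0 < s := by linarith
  have hδ : 0 ≤ δ := (abs_nonneg _).trans hx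
  have h : x / s - r = ((x - x₀) - r * (s - s₀)) / s := by
    rw [hx₀]; field_simp; ring
  rw [h, abs_div, abs_of_pos hspos, div_le_iff₀ hspos]
  refine (abs_sub _ _).trans ?_
  rw [abs_mul, abs_of_nonneg hr0]
  have : r * |s - s₀| ≤ 1 * δ := mul_le_mul hr1 hs (abs_nonneg _) zero_le_one
  nlinarith

end LogSampler

namespace LogSampler

open Finset

/-! ### The output law of the sampler -/

/-- Turns laws of functions of the coins into counting probabilities on an initial segment of the
naturals, where all estimates are made. -/
theorem uniform_map_apply_toReal {β : Type} {W : ℕ} [Nonempty (Fin W)] (F : ℕ → β) (b : β) :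
    ((((PMF.uniformOfFintype (Fin W)).bind fun w => PMF.pure (w : ℕ)).map F) b).toReal =
      rangeProb W fun w => F w = b := by
  classical
  rw [PMF.map_bind]
  simp only [PMF.pure_map]
  rw [PMF.bind_apply, tsum_fintype, ENNReal.toReal_sum fun w _ =>
      ENNReal.mul_ne_top (PMF.apply_ne_top _ _) (PMF.apply_ne_top _ _),
    rangeProb, rangeMean, sum_div,
    ← Fin.sum_univ_eq_sum_range (fun w => propInd (F w = b) / (W : ℝ))]
  refine sum_congr rfl fun w _ => ?_
  rw [PMF.uniformOfFintype_apply, Fintype.card_fin, PMF.pure_apply, ENNReal.toReal_mul,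
    ENNReal.toReal_inv, ENNReal.toReal_natCast]
  by_cases h : F w = b
  · rw [if_pos h.symm, propInd_true h, ENNReal.toReal_one, mul_one, one_div]
  · rw [if_neg (Ne.symm h), propInd_false h]
    simp

section

variable (P : ℕ → Params) (hP : PrimrecParams P) (space : ℕ → ℕ) (hs : Primrec space)
  (hpos : ∀ n, 0 < (P n).p) (hle : ∀ n, (P n).seeds * (P n).sketches ≤ 2 ^ space n)

/-- Updates ignore their coins, so the memory is a deterministic function of the initial randomness.
-/
theorem foldl_stepLaw {n : ℕ} (σ : TurnstileStream n) {α : Type} (ν : PMF α) (f : α → ℕ) :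
    σ.foldl ((sampler P hP space hs hpos hle).stepLaw n) (ν.map f) =
      ν.map fun w => σ.foldl (fun s u => (P n).update s u.1 u.2) (f w) := by
  induction σ generalizing f with
  | nil => rfl
  | cons u σ ih =>
    rw [List.foldl_cons]
    have h : (sampler P hP space hs hpos hle).stepLaw n (ν.map f) u =
        ν.map fun w => (P n).update (f w) u.1 u.2 := by
      have h1 : ∀ s, ((sampler P hP space hs hpos hle).coins n).map
          (fun w => (sampler P hP space hs hpos hle).update n s u.1 u.2 w) =
          PMF.pure ((P n).update s u.1 u.2) := fun s => PMF.map_const _ _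
      rw [StreamingAlgorithm.stepLaw]
      simp only [h1]
      exact (PMF.bind_pure_comp _ _).trans (PMF.map_comp _ _ _)
    rw [h, ih]
    rfl

/-- The value that the sampler computes from the seed, before it is turned into an answer. -/
noncomputable def seedOut (Q : Params) {n : ℕ} (σ : TurnstileStream n) (z : ℕ) : ℕ :=
  lastNonzero (Q.repOut n z ((∑ c ∈ range (Q.R * Q.L),
    Q.counter z σ c * (2 ^ Q.w) ^ c) % Q.sketches)) Q.R

/-- The value `0` and the values above `n` mean failure, the value `j + 1` means `j`. -/
def toAnswer (n v : ℕ) : Option (Fin n) :=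
  if h : 0 < v ∧ v ≤ n then some ⟨v - 1, by omega⟩ else none

theorem dite_eq_toAnswer {n v z : ℕ} (hz : z = if v = 0 then n else v - 1) :
    (if h : z < n then some (⟨z, h⟩ : Fin n) else none) = toAnswer n v := by
  subst hz
  unfold toAnswer
  by_cases hv : v = 0
  · simp [hv]
  · by_cases hvn : v ≤ n
    · have h3 : v - 1 < n := by omega
      simp [hv, hvn, Nat.pos_of_ne_zero hv, h3]
    · have h3 : ¬ v - 1 < n := by omega
      simp [hv, hvn, h3]

theorem outputLaw_sampler {n : ℕ} (σ : TurnstileStream n) :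
    (sampler P hP space hs hpos hle).outputLaw σ =
      ((sampler P hP space hs hpos hle).coins n).map
        fun w => toAnswer n (seedOut (P n) σ (w % (P n).seeds)) := by
  have hseeds := Params.seeds_pos (hpos n)
  have h1 : ∀ s, ((sampler P hP space hs hpos hle).coins n).map (fun w =>
      if h : (sampler P hP space hs hpos hle).output n s w < n then
        some (⟨(sampler P hP space hs hpos hle).output n s w, h⟩ : Fin n) else none) =
      PMF.pure (if h : (P n).answer n (s % (P n).seeds) (s / (P n).seeds) < n then
        some (⟨(P n).answer n (s % (P n).seeds) (s / (P n).seeds), h⟩ : Fin n) else none) :=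
    fun s => PMF.map_const _ (if h : (P n).answer n (s % (P n).seeds) (s / (P n).seeds) < n then
      some (⟨(P n).answer n (s % (P n).seeds) (s / (P n).seeds), h⟩ : Fin n) else none)
  rw [StreamingAlgorithm.outputLaw]
  simp only [h1]
  rw [StreamingAlgorithm.memoryLaw, foldl_stepLaw]
  refine (PMF.bind_pure_comp _ _).trans ((PMF.map_comp _ _ _).trans ?_)
  congr 1
  funext w
  have hz : (w : ℕ) % (P n).seeds < (P n).seeds := Nat.mod_lt _ hseeds
  have hmem := Params.foldl_update (hpos n) hz σ
  simp only [Function.comp_apply, sampler]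
  rw [hmem, Nat.add_mul_mod_self_left, Nat.mod_eq_of_lt hz, Nat.add_mul_div_left _ _ hseeds,
    Nat.div_eq_of_lt hz, zero_add]
  have h2 : (P n).answer n ((w : ℕ) % (P n).seeds) ((∑ c ∈ range ((P n).R * (P n).L),
      (P n).counter ((w : ℕ) % (P n).seeds) σ c * (2 ^ (P n).w) ^ c) % (P n).sketches) =
      if seedOut (P n) σ ((w : ℕ) % (P n).seeds) = 0 then n else
        seedOut (P n) σ ((w : ℕ) % (P n).seeds) - 1 := rfl
  exact dite_eq_toAnswer h2

theorem outputLaw_sampler_apply {n : ℕ} (σ : TurnstileStream n) (o : Option (Fin n)) :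
    ((sampler P hP space hs hpos hle).outputLaw σ o).toReal =
      rangeProb (2 ^ space n) fun w => toAnswer n (seedOut (P n) σ (w % (P n).seeds)) = o := by
  rw [outputLaw_sampler]
  have : Nonempty (Fin (2 ^ space n)) := ⟨⟨0, by positivity⟩⟩
  exact uniform_map_apply_toReal (W := 2 ^ space n)
    (fun w => toAnswer n (seedOut (P n) σ (w % (P n).seeds))) o

theorem toAnswer_eq_some_iff {n v : ℕ} {j : Fin n} : toAnswer n v = some j ↔ v = j + 1 := by
  unfold toAnswer
  split_ifs with h
  · rw [Option.some_inj, Fin.ext_iff]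
    simp only
    omega
  · have := j.2
    simp only [false_iff]
    omega

theorem toAnswer_eq_none_iff {n v : ℕ} (hv : v ≤ n) : toAnswer n v = none ↔ v = 0 := by
  unfold toAnswer
  split_ifs with h
  · simp only [false_iff]
    omega
  · simp only [true_iff]
    omega

theorem lastNonzero_le {f : ℕ → ℕ} {N R : ℕ} (h : ∀ ρ, f ρ ≤ N) : lastNonzero f R ≤ N := by
  induction R with
  | zero => exact Nat.zero_le _
  | succ R ih =>
    rw [lastNonzero]
    split_ifs
    · exact ih
    · exact h R

theorem idealOut_le (Q : Params) {n : ℕ} (σ : TurnstileStream n) (y : ℕ) :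
    idealOut Q σ y ≤ n := by
  rcases Nat.eq_zero_or_pos (idealOut Q σ y) with h | h
  · omega
  · obtain ⟨j, hj⟩ := Nat.exists_eq_succ_of_ne_zero h.ne'
    have h1 := mem_range.1 (mem_filter.1 (idealOut_eq_iff.1 hj).1).1
    omega

/-- If the parameters are large enough, the sampler is correct on the stream `σ`. -/
theorem isGSample_sampler {n m : ℕ} {σ : TurnstileStream n} {δ η : ℝ}
    (hprime : (P n).p.Prime) (hL : 0 < (P n).L) (hn : n ≤ (P n).p) (htp : (P n).t ≤ (P n).p)
    (hmt : m < (P n).t) (hm : 2 ≤ m) (hV0 : 0 < (P n).V) (hV : 2 * (P n).V < (P n).p)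
    (hσ : ∀ i, |σ.natFreq i| ≤ ((P n).V : ℤ))
    (hw : σ.length * ((P n).p * (P n).p) < 2 ^ (P n).w)
    (hlast : (n : ℝ) * (1 / 2 ^ ((P n).L - 1) + 1 / (P n).p) ≤ 1 / 4)
    (hδ : (P n).R * (P n).L * ((2 * (P n).V + 1) * n) * (n / (P n).p) +
      (P n).seeds / (2 ^ space n : ℕ) ≤ δ)
    (hη : 64 * n * (Real.log (1 + (P n).V) * ((P n).L *
      (Real.exp (-(m / 16)) + 2 * (1 / 2) ^ m) + 1 / (P n).p)) + 3 * δ ≤ η)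
    (hsucc : Real.exp (-((P n).R * (Real.log 2 / (16 * Real.log (1 + (P n).V))))) + δ ≤ 0.01)
    (hne : (support σ).Nonempty) :
    IsGSample (fun z : ℝ => Real.log (1 + |z|)) 0 η 0.99 (fun i => (σ.freq i : ℝ))
      ((sampler P hP space hs hpos hle).outputLaw σ) := by
  have : Fact (P n).p.Prime := ⟨hprime⟩
  have hp := hpos n
  have hV0' : (0 : ℝ) < (P n).V := by exact_mod_cast hV0
  set Q := (P n).repSeeds
  have hQ : 0 < Q := pow_pos hp _
  set S := support σ
  have hSn : ∀ i ∈ S, i < n := fun i hi => mem_range.1 (mem_filter.1 hi).1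
  have hSp : ∀ i ∈ S, i < (P n).p := fun i hi => (hSn i hi).trans_le hn
  have hScard : (#S : ℝ) ≤ n := by
    have : #S ≤ #(range n) := card_le_card (filter_subset _ _)
    rw [card_range] at this
    exact_mod_cast this
  have hlast' : (#S : ℝ) * levelProb (P n).p (P n).L ((P n).L - 1) ≤ 1 / 4 :=
    (mul_le_mul hScard (levelProb_last_le hp hL) (levelProb_nonneg _ _ _)
      (Nat.cast_nonneg n)).trans hlast
  -- the law of the answer is close to the ideal one
  have hclose : ∀ T : ℕ → Prop,
      |rangeProb (2 ^ space n) (fun w => T (seedOut (P n) σ (w % (P n).seeds))) -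
        rangeProb (Q ^ (P n).R) (fun y => T (lastDigitOut Q (idealOut (P n) σ) (P n).R y))| ≤
      δ := by
    intro T
    have h1 := abs_rangeProb_mod_sub_le (Params.seeds_pos hp)
      ((Nat.le_mul_of_pos_right _ (Nat.two_pow_pos _)).trans (hle n))
      (fun z => T (seedOut (P n) σ z))
    have h2 := abs_rangeProb_answer_sub_le (P := P n) hL hV hσ hw T
    refine (abs_sub_le _ _ _).trans ((add_le_add h1 h2).trans ?_)
    linarith
  set A := rangeProb Q fun y => idealOut (P n) σ y ≠ 0
  set s₀ := 1 - (1 - A) ^ (P n).R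
  have hsuccProb : |successProb ((sampler P hP space hs hpos hle).outputLaw σ) - s₀| ≤ δ := by
    have h1 := hclose fun v => toAnswer n v = none
    rw [← outputLaw_sampler_apply P hP space hs hpos hle, rangeProb_congr (F := fun y =>
      lastDigitOut Q (idealOut (P n) σ) (P n).R y = 0) fun y _ => toAnswer_eq_none_iff
        (lastNonzero_le fun ρ => idealOut_le _ _ _), rangeProb_lastDigitOut_eq_zero hQ] at h1
    rw [successProb, ← abs_neg]
    refine le_of_eq_of_le ?_ h1
    congr 1
    ring
  -- the weights of one repetition
  set q : ℕ → ℝ := isolateProb (P n).p (P n).L (P n).t S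
  set α : ℕ → ℝ := fun j => acceptProb (P n) (σ.natFreq j).natAbs
  set G : ℕ → ℝ := fun j => Real.log (1 + ((σ.natFreq j).natAbs : ℝ))
  set Λ := Real.log (1 + (P n).V)
  have hΛ : 0 < Λ := Real.log_pos (by linarith)
  have hAsum : A = ∑ j ∈ S, q j * α j := by
    rw [show A = _ from rangeProb_idealOut_ne_zero (P n) σ]
    exact sum_congr rfl fun j hj => rangeProb_idealFinds (P n) σ hp hj
  have hVabs : ∀ j, (σ.natFreq j).natAbs ≤ (P n).V := by
    intro j
    have := abs_le.1 (hσ j)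
    omega
  set ε : ℝ := (P n).L * (Real.exp (-(m / 16)) + 2 * (1 / 2) ^ m)
  obtain ⟨hAlow, hratio⟩ := abs_div_sum_sub_div_sum_le (S := S) (q := q) (α := α) (G := G)
    (Λ := Λ) (ε := ε) (δ := 1 / (P n).p) hΛ (by positivity) (by positivity)
    (fun i _ => rangeProb_nonneg _ _) (fun i _ => rangeProb_le_one _ _)
    (fun i hi j hj => abs_isolateProb_sub_le hL htp hmt hm hSp hlast' hi hj)
    (one_div_sixteen_le_sum_isolateProb hL htp (by omega) hSp hne hlast')
    (fun i hi => by
      refine Real.log_le_log two_pos ?_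
      have h0 : σ.natFreq i ≠ 0 := (mem_filter.1 hi).2
      have : (1 : ℝ) ≤ ((σ.natFreq i).natAbs : ℝ) := by
        exact_mod_cast Int.natAbs_pos.2 h0
      linarith)
    (fun i _ => by
      refine Real.log_le_log (by positivity) ?_
      have : ((σ.natFreq i).natAbs : ℝ) ≤ (P n).V := by exact_mod_cast hVabs i
      linarith)
    (fun i _ => acceptProb_bounds hp (hVabs i) hV0)
  rw [← hAsum] at hAlow
  have hl2 := Real.log_two_gt_d9
  have hApos : 0 < A := lt_of_lt_of_le (by positivity) hAlow
  have hA1 : A ≤ 1 := rangeProb_le_one _ _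
  have hs₀ : (1 - A) ^ (P n).R ≤
      Real.exp (-((P n).R * (Real.log 2 / (16 * Λ)))) := by
    have h1 : 1 - A ≤ Real.exp (-A) := by
      have := Real.add_one_le_exp (-A)
      linarith
    calc (1 - A) ^ (P n).R ≤ Real.exp (-A) ^ (P n).R := pow_le_pow_left₀ (by linarith) h1 _
      _ = Real.exp ((P n).R * -A) := (Real.exp_nat_mul _ _).symm
      _ ≤ _ := by
        refine Real.exp_le_exp.2 ?_
        rw [mul_neg]
        exact neg_le_neg (mul_le_mul_of_nonneg_left hAlow (Nat.cast_nonneg _))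
  have hsucc' : 0.99 ≤ successProb ((sampler P hP space hs hpos hle).outputLaw σ) := by
    have := (abs_le.1 hsuccProb).1
    simp only [s₀] at this
    norm_num at hsucc ⊢
    linarith
  have hδ0 : 0 ≤ δ := (abs_nonneg _).trans hsuccProb
  have hGfreq : ∀ i : Fin n, Real.log (1 + |(σ.freq i : ℝ)|) = G i := by
    intro i
    simp only [G]
    rw [TurnstileStream.freq_eq_natFreq, Nat.cast_natAbs, Int.cast_abs]
  have hGsum : ∑ i : Fin n, Real.log (1 + |(σ.freq i : ℝ)|) = ∑ i ∈ S, G i := by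
    rw [sum_congr rfl fun i _ => hGfreq i, Fin.sum_univ_eq_sum_range G]
    refine (sum_subset (filter_subset _ _) fun i hi hiS => ?_).symm
    have : σ.natFreq i = 0 := by
      by_contra h
      exact hiS (mem_filter.2 ⟨hi, h⟩)
    simp [G, this]
  have hmain : ∀ i : Fin n, |condProb ((sampler P hP space hs hpos hle).outputLaw σ) i -
      Real.log (1 + |(σ.freq i : ℝ)|) / ∑ j : Fin n, Real.log (1 + |(σ.freq j : ℝ)|)| ≤ η := by
    intro i
    have hx := hclose fun v => toAnswer n v = some i
    rw [← outputLaw_sampler_apply P hP space hs hpos hle, rangeProb_congr (F := fun y =>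
      lastDigitOut Q (idealOut (P n) σ) (P n).R y = i + 1) fun y _ => toAnswer_eq_some_iff] at hx
    have hb := mul_rangeProb_lastDigitOut hQ (idealOut (P n) σ) (P n).R (Nat.succ_ne_zero i)
    set b := rangeProb (Q ^ (P n).R) fun y =>
      lastDigitOut Q (idealOut (P n) σ) (P n).R y = i + 1
    set ai := rangeProb Q fun y => idealOut (P n) σ y = i + 1
    have hai : ai = rangeProb Q fun y => IdealFinds (P n) σ y i :=
      rangeProb_congr fun y _ => idealOut_eq_iff
    -- For ideal trials the answer is i with probability ai/A times the success probability s₀. Only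
    -- ai/A has to be compared with the target; the distance from the real law costs 3δ.
    have hb' : b = ai / A * s₀ := by
      rw [div_mul_eq_mul_div, eq_div_iff hApos.ne', mul_comm]
      exact hb
    have hai0 : 0 ≤ ai := rangeProb_nonneg _ _
    have haiA : ai ≤ A := rangeProb_mono fun y _ h => by
      rw [h]
      exact Nat.succ_ne_zero i
    have h1 := abs_div_sub_le hx hsuccProb (div_nonneg hai0 hApos.le)
      ((div_le_one hApos).2 haiA) hb' hsucc'
    rw [hGsum, hGfreq]
    have h2 : |ai / A - G i / ∑ j ∈ S, G j| ≤ 64 * n * (Λ * (ε + 1 / (P n).p)) := by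
      by_cases hi : (i : ℕ) ∈ S
      · rw [hai, show rangeProb Q (fun y => IdealFinds (P n) σ y i) = q i * α i from
          rangeProb_idealFinds (P n) σ hp hi, hAsum]
        refine (hratio i hi).trans ?_
        gcongr
      · have h3 : ai = 0 := by
          rw [hai]
          exact rangeProb_eq_zero fun y _ h => hi h.1
        have h4 : σ.natFreq i = 0 := by
          by_contra h
          exact hi (mem_filter.2 ⟨mem_range.2 i.2, h⟩)
        have h5 : G i = 0 := by simp [G, h4]
        rw [h3, h5, zero_div, zero_div, sub_zero, abs_zero]
        positivity
    refine (abs_sub_le _ (ai / A) _).trans ?_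
    have h6 := add_le_add h1 h2
    exact h6.trans (by linarith)
  refine ⟨hsucc', fun i => ?_, fun i => ?_⟩
  · have := (abs_le.1 (hmain i)).1
    linarith
  · have := (abs_le.1 (hmain i)).2
    linarith

end

end LogSampler

namespace LogSampler

/-! ### The choice of the parameters -/

/-- An upper bound for the bit length of `n`. -/
def ell (n : ℕ) : ℕ := Nat.log 2 n + 10

/-- A prime between `2 ^ (b * ell n)` and `2 ^ (b * ell n + 1)`. -/
def fieldSize (b n : ℕ) : ℕ := Nat.findGreatest Nat.Prime (2 ^ (b * ell n + 1))

/-- The parameters of the sampler for streams bounded by `n ^ a`. -/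
def logParams (a κ b n : ℕ) : Params where
  p := fieldSize b n
  L := ell n + 4
  R := 96 * (2 * a * ell n + 1)
  t := 16 * (κ * ell n) + 1
  w := (a + 2 * b) * ell n + 3
  V := n ^ (2 * a)

/-- The space of the sampler. -/
def logSpace (a κ b n : ℕ) : ℕ :=
  (b * ell n + 1) * (1 + (16 * (κ * ell n) + 2) * (96 * (2 * a * ell n + 1))) +
    ((a + 2 * b) * ell n + 3) * (96 * (2 * a * ell n + 1) * (ell n + 4))

theorem primrec_ell : Primrec ell := Primrec.nat_add.comp Primrec.nat_log_two (.const 10)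

theorem primrec_fieldSize (b : ℕ) : Primrec (fieldSize b) :=
  Primrec.nat_findGreatest (p := fun _ q => Nat.Prime q)
    (Primrec.nat_pow.comp (.const 2) (Primrec.nat_add.comp
      (Primrec.nat_mul.comp (.const b) primrec_ell) (.const 1)))
    (Primrec.nat_prime.comp Primrec.snd)

theorem primrecParams_logParams (a κ b : ℕ) : PrimrecParams (logParams a κ b) where
  p := primrec_fieldSize b
  L := Primrec.nat_add.comp primrec_ell (.const 4)
  R := Primrec.nat_mul.comp (.const 96) (Primrec.nat_add.comp
    (Primrec.nat_mul.comp (.const (2 * a)) primrec_ell) (.const 1))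
  t := Primrec.nat_add.comp (Primrec.nat_mul.comp (.const 16)
    (Primrec.nat_mul.comp (.const κ) primrec_ell)) (.const 1)
  w := Primrec.nat_add.comp (Primrec.nat_mul.comp (.const (a + 2 * b)) primrec_ell) (.const 3)
  V := Primrec.nat_pow.comp Primrec.id (.const (2 * a))

theorem primrec_logSpace (a κ b : ℕ) : Primrec (logSpace a κ b) := by
  have h := primrecParams_logParams a κ b
  exact Primrec.nat_add.comp (Primrec.nat_mul.comp
    (Primrec.nat_add.comp (Primrec.nat_mul.comp (.const b) primrec_ell) (.const 1))
    (Primrec.nat_add.comp (.const 1) (Primrec.nat_mul.comp (Primrec.succ.comp h.t) h.R)))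
    (Primrec.nat_mul.comp h.w (Primrec.nat_mul.comp h.R h.L))

/-- Bertrand's postulate provides a prime in the search range above `2 ^ (b * ell n)`. -/
theorem fieldSize_spec (b n : ℕ) : (fieldSize b n).Prime ∧ 2 ^ (b * ell n) < fieldSize b n ∧
    fieldSize b n ≤ 2 ^ (b * ell n + 1) := by
  obtain ⟨q, hq, hlt, hle⟩ := Nat.exists_prime_lt_and_le_two_mul (2 ^ (b * ell n)) (by positivity)
  rw [← pow_succ'] at hle
  exact ⟨Nat.findGreatest_spec hle hq, hlt.trans_le (Nat.le_findGreatest hle hq),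
    Nat.findGreatest_le _⟩

theorem seeds_logParams_le (a κ b n : ℕ) : (logParams a κ b n).seeds ≤
    2 ^ ((b * ell n + 1) * (1 + (16 * (κ * ell n) + 2) * (96 * (2 * a * ell n + 1)))) := by
  have h : (logParams a κ b n).seeds =
      fieldSize b n ^ (1 + (16 * (κ * ell n) + 2) * (96 * (2 * a * ell n + 1))) := by
    rw [pow_add, pow_one, pow_mul]
    rfl
  rw [h, pow_mul]
  exact Nat.pow_le_pow_left (fieldSize_spec b n).2.2 _

theorem two_pow_logSpace (a κ b n : ℕ) : 2 ^ logSpace a κ b n =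
    2 ^ ((b * ell n + 1) * (1 + (16 * (κ * ell n) + 2) * (96 * (2 * a * ell n + 1)))) *
      (logParams a κ b n).sketches := by
  rw [logSpace, pow_add]
  rfl

theorem logParams_memory_le (a κ b n : ℕ) :
    (logParams a κ b n).seeds * (logParams a κ b n).sketches ≤ 2 ^ logSpace a κ b n := by
  rw [two_pow_logSpace]
  exact Nat.mul_le_mul_right _ (seeds_logParams_le a κ b n)

theorem logSpace_le (a κ b n : ℕ) : logSpace a κ b n ≤
    ((b + 1) * (1 + (16 * κ + 2) * (96 * (2 * a + 1))) +
      (a + 2 * b + 3) * (96 * (2 * a + 1) * 5)) * ell n ^ 3 := by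
  have hl : 1 ≤ ell n := by unfold ell; omega
  rw [logSpace]
  generalize ell n = l at hl
  have h1 : b * l + 1 ≤ (b + 1) * l := by nlinarith
  have h2 : 16 * (κ * l) + 2 ≤ (16 * κ + 2) * l := by nlinarith
  have h3 : 96 * (2 * a * l + 1) ≤ 96 * (2 * a + 1) * l := by nlinarith
  have h4 : (a + 2 * b) * l + 3 ≤ (a + 2 * b + 3) * l := by nlinarith
  have h5 : l + 4 ≤ 5 * l := by omega
  have h6 : 1 ≤ l * l := Nat.mul_pos hl hl
  calc (b * l + 1) * (1 + (16 * (κ * l) + 2) * (96 * (2 * a * l + 1))) +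
        ((a + 2 * b) * l + 3) * (96 * (2 * a * l + 1) * (l + 4))
      ≤ (b + 1) * l * (1 * (l * l) + (16 * κ + 2) * l * (96 * (2 * a + 1) * l)) +
        (a + 2 * b + 3) * l * (96 * (2 * a + 1) * l * (5 * l)) := by gcongr; omega
    _ = _ := by ring

theorem isBigO_logSpace (a κ b : ℕ) :
    (fun n : ℕ => (logSpace a κ b n : ℝ)) =O[atTop] fun n : ℕ => Real.log (n : ℝ) ^ 3 := by
  set C : ℕ := (b + 1) * (1 + (16 * κ + 2) * (96 * (2 * a + 1))) +
      (a + 2 * b + 3) * (96 * (2 * a + 1) * 5)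
  refine IsBigO.of_bound (C * 16 ^ 3) ?_
  filter_upwards [eventually_ge_atTop 2] with n hn
  have hn' : (2 : ℝ) ≤ n := by exact_mod_cast hn
  have hl2 := Real.log_two_gt_d9
  have hlog : Real.log 2 ≤ Real.log n := Real.log_le_log two_pos hn'
  -- For n ≥ 2 the left side is at most (1 + 10) log n / log 2, and 11 / log 2 < 16.
  have hell : (ell n : ℝ) ≤ 16 * Real.log n := by
    have h1 : ((2 ^ Nat.log 2 n : ℕ) : ℝ) ≤ n := by
      exact_mod_cast Nat.pow_log_le_self 2 (by omega)
    have h2 := Real.log_le_log (by positivity) h1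
    rw [Nat.cast_pow, Real.log_pow] at h2
    push_cast at h2
    have h3 : (0 : ℝ) ≤ Nat.log 2 n := Nat.cast_nonneg _
    rw [ell]
    push_cast
    nlinarith
  rw [Real.norm_of_nonneg (Nat.cast_nonneg _), Real.norm_of_nonneg (by positivity), mul_assoc,
    ← mul_pow]
  have h4 : (logSpace a κ b n : ℝ) ≤ C * (ell n : ℝ) ^ 3 := by
    exact_mod_cast logSpace_le a κ b n
  exact h4.trans (by gcongr)

theorem lt_two_pow_ell (n : ℕ) : n < 2 ^ ell n :=
  (Nat.lt_pow_succ_log_self one_lt_two n).trans_le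
    (Nat.pow_le_pow_right two_pos (by unfold ell; omega))

/-- With suitable exponents `κ` and `b`, the sampler is a perfect sampler for the logarithm. -/
theorem isPerfectGSampler_sampler (a C : ℕ) {c : ℝ} (hc : c ≤ C) {κ b : ℕ}
    (hκ : κ = 2 * a + C + 4) (hb : b = 16 * κ + 4 * a + C + 7)
    (hpos : ∀ n, 0 < (logParams a κ b n).p) :
    IsPerfectGSampler (sampler (logParams a κ b) (primrecParams_logParams a κ b)
      (logSpace a κ b) (primrec_logSpace a κ b) hpos (logParams_memory_le a κ b))
      (fun z : ℝ => Real.log (1 + |z|)) a c 0.99 := by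
  intro n σ hσ hsum
  have hn : 0 < n := by
    rcases Nat.eq_zero_or_pos n with rfl | h
    · simp at hsum
    · exact h
  have hne : (support σ).Nonempty := by
    by_contra h
    rw [Finset.not_nonempty_iff_eq_empty] at h
    refine hsum (Finset.sum_eq_zero fun j _ => ?_)
    have h0 : σ.natFreq j = 0 := by
      by_contra h1
      have : (j : ℕ) ∈ support σ := Finset.mem_filter.2 ⟨Finset.mem_range.2 j.2, h1⟩
      rw [h] at this
      exact absurd this (Finset.notMem_empty _)
    rw [TurnstileStream.freq_eq_natFreq, h0]
    simp
  obtain ⟨hprime, hplt, hple⟩ := fieldSize_spec b n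
  set l := ell n with hl
  have hl10 : 10 ≤ l := by rw [hl, ell]; omega
  have hnl : n < 2 ^ l := lt_two_pow_ell n
  set p := fieldSize b n
  -- powers of `x = 2 ^ l`
  set x : ℝ := 2 ^ l with hx
  have hx1024 : 1024 ≤ x := by
    calc (1024 : ℝ) = 2 ^ 10 := by norm_num
      _ ≤ x := pow_le_pow_right₀ one_le_two hl10
  have hx0 : 0 < x := by positivity
  have hx1 : 1 ≤ x := by linarith
  have hxpow : ∀ k : ℕ, (2 : ℝ) ^ (k * l) = x ^ k := fun k => by rw [mul_comm, pow_mul]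
  have hnx : (n : ℝ) ≤ x := by
    rw [hx]
    exact_mod_cast hnl.le
  have hn1 : (1 : ℝ) ≤ n := by exact_mod_cast hn
  have hpx : x ^ b ≤ p := by
    rw [← hxpow]
    exact_mod_cast hplt.le
  have hp0 : (0 : ℝ) < p := lt_of_lt_of_le (by positivity) hpx
  have hVx : ((n ^ (2 * a) : ℕ) : ℝ) ≤ x ^ (2 * a) := by
    push_cast
    exact pow_le_pow_left₀ (Nat.cast_nonneg n) hnx _
  have hV0 : 0 < n ^ (2 * a) := by positivity
  have hV1 : (1 : ℝ) ≤ ((n ^ (2 * a) : ℕ) : ℝ) := by exact_mod_cast hV0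
  have hLx : ((l + 4 : ℕ) : ℝ) ≤ x := by
    have h1 : (l - 1) < 2 ^ (l - 1) := Nat.lt_two_pow_self
    have h2 : 2 ^ l = 2 * 2 ^ (l - 1) := by
      rw [← pow_succ', Nat.sub_add_cancel (by omega)]
    rw [hx]
    exact_mod_cast (by omega : l + 4 ≤ 2 ^ l)
  have hrx : ((2 * a * l + 1 : ℕ) : ℝ) ≤ x ^ (2 * a) := by
    rw [← hxpow]
    exact_mod_cast (Nat.lt_two_pow_self : 2 * a * l < 2 ^ (2 * a * l))
  -- The unit of error. The total is 7e: one e from the bias of a single trial and 3δ with δ = 2e.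
  -- Since x ≥ 1024 and x ≥ n, 7e ≤ x^(-C) ≤ n^(-c).
  set e : ℝ := (x ^ (C + 1))⁻¹ with he
  have he0 : 0 < e := by positivity
  have hinv : ∀ k, C + 1 ≤ k → (x ^ k)⁻¹ ≤ e := fun k hk =>
    inv_anti₀ (by positivity) (pow_le_pow_right₀ hx1 hk)
  have hpinv : 1 / (p : ℝ) ≤ (x ^ b)⁻¹ := by
    rw [one_div]
    exact inv_anti₀ (by positivity) hpx
  have hΛx : Real.log (1 + ((n ^ (2 * a) : ℕ) : ℝ)) ≤ x ^ (2 * a) := by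
    have := Real.log_le_sub_one_of_pos (by linarith : 0 < 1 + ((n ^ (2 * a) : ℕ) : ℝ))
    linarith
  have hΛl : Real.log (1 + ((n ^ (2 * a) : ℕ) : ℝ)) ≤ (2 * a * l + 1 : ℕ) * Real.log 2 := by
    rw [← Real.log_pow]
    refine Real.log_le_log (by linarith) ?_
    rw [pow_succ, hxpow]
    have : (1 : ℝ) ≤ x ^ (2 * a) := one_le_pow₀ hx1
    linarith
  have hΛ0 : 0 < Real.log (1 + ((n ^ (2 * a) : ℕ) : ℝ)) := Real.log_pos (by linarith)
  have hec : 7 * e ≤ (n : ℝ) ^ (-c) := by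
    have h1 : 7 * e ≤ (x ^ C)⁻¹ := by
      rw [he, pow_succ, mul_inv, mul_comm, mul_assoc]
      refine mul_le_of_le_one_right (by positivity) ?_
      rw [inv_mul_le_iff₀ hx0]
      linarith
    refine h1.trans ?_
    rw [Real.rpow_neg (Nat.cast_nonneg n)]
    refine inv_anti₀ (Real.rpow_pos_of_pos (by linarith) c) ?_
    calc (n : ℝ) ^ c ≤ (n : ℝ) ^ (C : ℝ) := Real.rpow_le_rpow_of_exponent_le hn1 hc
      _ = (n : ℝ) ^ C := Real.rpow_natCast _ _
      _ ≤ x ^ C := pow_le_pow_left₀ (Nat.cast_nonneg n) hnx _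
  -- The truncation order is m = t - 1. The factor 16 turns exp(-m/16) into exp(-κl) ≤ x^(-κ). The
  -- exponent κ absorbs the polynomial factors in the bias of a trial; b ≥ 16κ gives t ≤ p, and the
  -- rest of b absorbs the union bound over fingerprints.
  refine isGSample_sampler (logParams a κ b) (primrecParams_logParams a κ b) (logSpace a κ b)
    (primrec_logSpace a κ b) hpos (logParams_memory_le a κ b) (m := 16 * (κ * l)) (δ := 2 * e)
    hprime ?_ ?_ ?_ ?_ ?_ hV0 ?_ ?_ ?_ ?_ ?_ ?_ ?_ hne
  · exact Nat.succ_pos _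
  · exact (hnl.trans_le (Nat.pow_le_pow_right two_pos (Nat.le_mul_of_pos_left l (by omega)))).le.trans
      hplt.le
  · refine (Nat.lt_two_pow_self : 16 * (κ * l) < 2 ^ (16 * (κ * l))).trans_le
      ((Nat.pow_le_pow_right two_pos ?_).trans hplt.le)
    rw [← mul_assoc]
    exact Nat.mul_le_mul_right l (by omega)
  · exact Nat.lt_succ_self _
  · have : 0 < κ * l := Nat.mul_pos (by omega) (by omega)
    omega
  · have h1 : (2 * n ^ (2 * a) : ℝ) ≤ x * x ^ (2 * a) := by
      have h2 : (n : ℝ) ^ (2 * a) ≤ x ^ (2 * a) := by exact_mod_cast hVx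
      have h3 : (0 : ℝ) ≤ (n : ℝ) ^ (2 * a) := by positivity
      exact mul_le_mul (by linarith) h2 h3 hx0.le
    have h2 : x * x ^ (2 * a) ≤ x ^ b := by
      rw [← pow_succ']
      exact pow_le_pow_right₀ hx1 (by omega)
    have h3 : (2 : ℝ) ^ (b * l) < p := by exact_mod_cast hplt
    rw [hxpow] at h3
    have h4 : (2 * n ^ (2 * a) : ℝ) < p := h1.trans_lt (h2.trans_lt h3)
    change 2 * n ^ (2 * a) < p
    exact_mod_cast h4
  · intro i
    refine (σ.abs_natFreq_le hσ i).trans (le_of_eq ?_)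
    change ((n ^ a * n ^ a : ℕ) : ℤ) = ((n ^ (2 * a) : ℕ) : ℤ)
    rw [← pow_add, two_mul]
  · change σ.length * (p * p) < 2 ^ ((a + 2 * b) * l + 3)
    calc σ.length * (p * p) ≤ (2 ^ l) ^ a * (2 ^ (b * l + 1) * 2 ^ (b * l + 1)) :=
          Nat.mul_le_mul (hσ.1.trans (Nat.pow_le_pow_left hnl.le a)) (Nat.mul_le_mul hple hple)
      _ = 2 ^ ((a + 2 * b) * l + 2) := by
          rw [← pow_mul, ← pow_add, ← pow_add]
          congr 1
          ring
      _ < 2 ^ ((a + 2 * b) * l + 3) := Nat.pow_lt_pow_right one_lt_two (by omega)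
  · change (n : ℝ) * (1 / 2 ^ (l + 4 - 1) + 1 / p) ≤ 1 / 4
    have h1 : (2 : ℝ) ^ (l + 4 - 1) = 8 * x := by
      rw [show l + 4 - 1 = 3 + l by omega, pow_add, ← hx]
      norm_num
    have h2 : (x ^ b)⁻¹ ≤ (x ^ 2)⁻¹ :=
      inv_anti₀ (by positivity) (pow_le_pow_right₀ hx1 (by omega))
    calc (n : ℝ) * (1 / 2 ^ (l + 4 - 1) + 1 / p) ≤ x * (1 / (8 * x) + (x ^ 2)⁻¹) := by
          rw [h1]
          gcongr
          exact hpinv.trans h2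
      _ = 1 / 8 + x⁻¹ := by field_simp
      _ ≤ 1 / 8 + 1024⁻¹ := by gcongr
      _ ≤ 1 / 4 := by norm_num
  · change ((96 * (2 * a * l + 1) : ℕ) : ℝ) * ((l + 4 : ℕ) : ℝ) *
      ((2 * ((n ^ (2 * a) : ℕ) : ℝ) + 1) * n) * (n / p) +
      ((logParams a κ b n).seeds : ℝ) / ((2 ^ logSpace a κ b n : ℕ) : ℝ) ≤ 2 * e
    have h1 : ((96 * (2 * a * l + 1) : ℕ) : ℝ) ≤ x * x ^ (2 * a) := by
      rw [Nat.cast_mul]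
      exact mul_le_mul (by push_cast; linarith) hrx (Nat.cast_nonneg _) hx0.le
    have h2 : 2 * ((n ^ (2 * a) : ℕ) : ℝ) + 1 ≤ x * x ^ (2 * a) := by
      have : (1 : ℝ) ≤ x ^ (2 * a) := one_le_pow₀ hx1
      nlinarith
    have h3 : ((96 * (2 * a * l + 1) : ℕ) : ℝ) * ((l + 4 : ℕ) : ℝ) *
        ((2 * ((n ^ (2 * a) : ℕ) : ℝ) + 1) * n) * (n / p) ≤ e := by
      calc _ ≤ x * x ^ (2 * a) * x * ((x * x ^ (2 * a)) * x) * (x * (x ^ b)⁻¹) := by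
            rw [div_eq_mul_one_div]
            gcongr
        _ = x ^ (4 * a + 5) * (x ^ b)⁻¹ := by ring
        _ ≤ x ^ (4 * a + 5) * (x ^ (4 * a + 5 + (C + 1)))⁻¹ := by
            gcongr
            omega
        _ = e := by
            rw [he, pow_add x (4 * a + 5) (C + 1), mul_inv, mul_inv_cancel_left₀ (by positivity)]
    -- The coins fill the whole memory, sketch included, so there are at least b l more random bits
    -- than the seed needs; reduction modulo the number of seeds is then nearly unbiased.
    have h4 : ((logParams a κ b n).seeds : ℝ) / ((2 ^ logSpace a κ b n : ℕ) : ℝ) ≤ e := by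
      have h5 : (logParams a κ b n).seeds * 2 ^ (b * l) ≤ 2 ^ logSpace a κ b n := by
        rw [two_pow_logSpace]
        refine Nat.mul_le_mul (seeds_logParams_le a κ b n) (Nat.pow_le_pow_right two_pos ?_)
        change b * l ≤ ((a + 2 * b) * l + 3) * (96 * (2 * a * l + 1) * (l + 4))
        calc b * l ≤ ((a + 2 * b) * l + 3) * 1 := by nlinarith [Nat.zero_le ((a + b) * l)]
          _ ≤ _ := Nat.mul_le_mul_left _ (Nat.succ_le_of_lt (by positivity))
      have h6 : ((logParams a κ b n).seeds : ℝ) * x ^ b ≤ ((2 ^ logSpace a κ b n : ℕ) : ℝ) := by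
        rw [← hxpow]
        exact_mod_cast h5
      refine le_trans ?_ (hinv b (by omega))
      rw [div_le_iff₀ (by positivity), inv_mul_eq_div, le_div_iff₀ (by positivity)]
      exact h6
    linarith
  · refine le_trans ?_ hec
    change 64 * (n : ℝ) * (Real.log (1 + ((n ^ (2 * a) : ℕ) : ℝ)) * (((l + 4 : ℕ) : ℝ) *
      (Real.exp (-(((16 * (κ * l) : ℕ) : ℝ) / 16)) + 2 * (1 / 2) ^ (16 * (κ * l))) + 1 / p)) +
      3 * (2 * e) ≤ 7 * e
    have h1 : Real.exp (-(((16 * (κ * l) : ℕ) : ℝ) / 16)) ≤ (x ^ κ)⁻¹ := by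
      rw [Real.exp_neg]
      refine inv_anti₀ (by positivity) ?_
      have h2 : ((16 * (κ * l) : ℕ) : ℝ) / 16 = ((κ * l : ℕ) : ℝ) * 1 := by push_cast; ring
      rw [h2, Real.exp_nat_mul, ← hxpow]
      have := Real.exp_one_gt_d9
      exact pow_le_pow_left₀ zero_le_two (by linarith) _
    have h2 : ((1 : ℝ) / 2) ^ (16 * (κ * l)) ≤ (x ^ κ)⁻¹ := by
      rw [one_div, inv_pow, ← hxpow]
      exact inv_anti₀ (by positivity) (pow_le_pow_right₀ one_le_two (by omega))
    have h3 : (1 : ℝ) / p ≤ x * (x ^ κ)⁻¹ := by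
      refine hpinv.trans ((inv_anti₀ (by positivity)
        (pow_le_pow_right₀ hx1 (by omega : κ ≤ b))).trans ?_)
      exact le_mul_of_one_le_left (by positivity) hx1
    have h4 : 64 * (n : ℝ) * (Real.log (1 + ((n ^ (2 * a) : ℕ) : ℝ)) * (((l + 4 : ℕ) : ℝ) *
        (Real.exp (-(((16 * (κ * l) : ℕ) : ℝ) / 16)) + 2 * (1 / 2) ^ (16 * (κ * l))) + 1 / p)) ≤
        e := by
      calc _ ≤ 64 * x * (x ^ (2 * a) * (x * ((x ^ κ)⁻¹ + 2 * (x ^ κ)⁻¹) + x * (x ^ κ)⁻¹)) := by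
            gcongr
        _ = 256 * (x ^ (2 * a + 2) * (x ^ κ)⁻¹) := by ring
        _ ≤ x * (x ^ (2 * a + 2) * (x ^ κ)⁻¹) := by gcongr; linarith
        _ = x ^ (2 * a + 3) * (x ^ (2 * a + 3 + (C + 1)))⁻¹ := by
            rw [hκ, show 2 * a + C + 4 = 2 * a + 3 + (C + 1) by ring]
            ring
        _ = e := by
            rw [he, pow_add x (2 * a + 3) (C + 1), mul_inv, mul_inv_cancel_left₀ (by positivity)]
    linarith
  · change Real.exp (-(((96 * (2 * a * l + 1) : ℕ) : ℝ) * (Real.log 2 /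
      (16 * Real.log (1 + ((n ^ (2 * a) : ℕ) : ℝ)))))) + 2 * e ≤ 0.01
    -- As log(1+V) ≤ (2al + 1) log 2, the factor 96 = 6 · 16 in R makes the exponent at least 6. The
    -- failure probability is then at most 1/300 + 2/1024 < 0.01.
    have h1 : (6 : ℝ) ≤ ((96 * (2 * a * l + 1) : ℕ) : ℝ) * (Real.log 2 /
        (16 * Real.log (1 + ((n ^ (2 * a) : ℕ) : ℝ)))) := by
      rw [← mul_div_assoc, le_div_iff₀ (by positivity), Nat.cast_mul]
      push_cast at hΛl ⊢
      linarith
    have h2 : Real.exp (-6) ≤ 1 / 300 := by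
      rw [Real.exp_neg, one_div]
      refine inv_anti₀ (by norm_num) ?_
      have h3 : Real.exp 6 = Real.exp 1 ^ 6 := by
        rw [← Real.exp_nat_mul]
        norm_num
      rw [h3]
      have := Real.exp_one_gt_d9
      calc (300 : ℝ) ≤ 2.7 ^ 6 := by norm_num
        _ ≤ Real.exp 1 ^ 6 := by gcongr; linarith
    have h3 : e ≤ 1 / 1024 := by
      rw [he, one_div]
      refine inv_anti₀ (by norm_num) (hx1024.trans ?_)
      exact le_self_pow₀ hx1 (by omega)
    refine (add_le_add ((Real.exp_le_exp.2 (neg_le_neg h1)).trans h2)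
      (mul_le_mul_of_nonneg_left h3 zero_le_two)).trans ?_
    norm_num

end LogSampler

theorem mainTheorem6 (a : ℕ) (c : ℝ) (hc : 0 < c) :
    ∃ A : StreamingAlgorithm,
      (fun n : ℕ => (A.space n : ℝ)) =O[atTop] (fun n : ℕ => Real.log (n : ℝ) ^ 3) ∧
      IsPerfectGSampler A (fun z : ℝ => Real.log (1 + |z|)) a c 0.99 := by
  have hpos : ∀ n, 0 < (LogSampler.logParams a (2 * a + ⌈c⌉₊ + 4)
      (16 * (2 * a + ⌈c⌉₊ + 4) + 4 * a + ⌈c⌉₊ + 7) n).p :=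
    fun n => (LogSampler.fieldSize_spec _ n).1.pos
  exact ⟨_, LogSampler.isBigO_logSpace a _ _,
    LogSampler.isPerfectGSampler_sampler a ⌈c⌉₊ (Nat.le_ceil c) rfl rfl hpos⟩
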